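/- Let $m>0$, $0<\beta_2\le\beta_1$, and on $\mathbb{R}^2$ consider the massive Dirac operator acting on spinors $\psi=(\psi_1,\psi_2)^T:\mathbb{R}^2\to\mathbb{C}^2$, $$\mathcal{D}_m=-i(\tilde\sigma_1\partial_1+\tilde\sigma_2\partial_2)+m\tilde\sigma_3,\qquad \tilde\sigma_1=\begin{pmatrix}0&1\\1&0\end{pmatrix},\quad \tilde\sigma_2=\begin{pmatrix}0&i\\-i&0\end{pmatrix},\quad \tilde\sigma_3=\begin{pmatrix}-1&0\\0&1\end{pmatrix}.$$ Let $$G(\psi)=\frac{\beta_1}{4}\left(|\psi_1|^4+|\psi_2|^4\right)+\beta_2|\psi_1|^2|\psi_2|^2,$$ and let $\nabla G$ be its gradient with respect to the real inner product $\operatorname{Re}\langle\cdot,\cdot\rangle$ on $\mathbb{C}^2\cong\mathbb{R}^4$. Then for every $\omega\in(-m,m)$ the equation $$(\mathcal{D}_m-\omega)\psi=\nabla G(\psi)\quad\text{on }\mathbb{R}^2$$ has a solution $\psi\in C^\infty(\mathbb{R}^2,\mathbb{C}^2)$ which, in polar coordinates $(r,\vartheta)$, is of the form $$\psi(r,\vartheta)=\begin{pmatrix}iu(r)e^{i\vartheta}\\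 v(r)\end{pmatrix},\qquad u,v:[0,\infty)\to\mathbb{R},\quad u(0)=0,\quad v(0)\neq0$$ (in particular $\psi$ is not identically zero), and which decays exponentially: there are constants $C,\delta>0$ with $|\psi(x)|\le Ce^{-\delta|x|}$ for all $x\in\mathbb{R}^2$. -/

import Mathlib

noncomputable section

/-- The plane `ℝ²` with its Euclidean norm. -/
abbrev Plane : Type := EuclideanSpace ℝ (Fin 2)

/-- The spinor space `ℂ²` with its Euclidean norm. -/
abbrev Spinor : Type := EuclideanSpace ℂ (Fin 2)

/-- The Pauli-type matrix `σ̃₁`. -/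
def sigma1 : Matrix (Fin 2) (Fin 2) ℂ := !![0, 1; 1, 0]

/-- The Pauli-type matrix `σ̃₂`. -/
def sigma2 : Matrix (Fin 2) (Fin 2) ℂ := !![0, Complex.I; -Complex.I, 0]

/-- The Pauli-type matrix `σ̃₃`. -/
def sigma3 : Matrix (Fin 2) (Fin 2) ℂ := !![-1, 0; 0, 1]

/-- The partial derivative `∂ⱼ ψ` of a spinor field. -/
def partialDeriv (j : Fin 2) (ψ : Plane → Spinor) (x : Plane) : Spinor :=
  fderiv ℝ ψ x (EuclideanSpace.single j 1)

/-- The massive Dirac operator `𝓓_m = -i (σ̃₁ ∂₁ + σ̃₂ ∂₂) + m σ̃₃`. -/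
def diracOp (m : ℝ) (ψ : Plane → Spinor) (x : Plane) : Spinor :=
  (-Complex.I) • (Matrix.toEuclideanLin sigma1 (partialDeriv 0 ψ x)
      + Matrix.toEuclideanLin sigma2 (partialDeriv 1 ψ x))
    + (m : ℂ) • Matrix.toEuclideanLin sigma3 (ψ x)

/-- The potential `G(ψ) = (β₁/4) (|ψ₁|⁴ + |ψ₂|⁴) + β₂ |ψ₁|² |ψ₂|²`. -/
def potentialG (β₁ β₂ : ℝ) (z : Spinor) : ℝ :=
  β₁ / 4 * (‖z 0‖ ^ 4 + ‖z 1‖ ^ 4) + β₂ * ‖z 0‖ ^ 2 * ‖z 1‖ ^ 2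

/-- The stationary equation `(𝓓_m - ω) ψ = ∇G(ψ)` on the whole plane. Here `∇G` is the gradient of
the real-valued function `G` for the real inner product `Re ⟨·, ·⟩` of `ℂ² ≅ ℝ⁴`. -/
def IsStationarySolution (m ω β₁ β₂ : ℝ) (ψ : Plane → Spinor) : Prop :=
  ∀ x : Plane, diracOp m ψ x - (ω : ℂ) • ψ x = gradient (𝕜 := ℝ) (potentialG β₁ β₂) (ψ x)

/-- In polar coordinates, `ψ(r, ϑ) = (i u(r) e^{iϑ}, v(r))`, with real-valued `u`, `v` (only their
values on `[0, ∞)` matter). -/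
def HasRadialForm (u v : ℝ → ℝ) (ψ : Plane → Spinor) : Prop :=
  ∀ r : ℝ, 0 ≤ r → ∀ ϑ : ℝ,
    ψ !₂[r * Real.cos ϑ, r * Real.sin ϑ]
      = !₂[Complex.I * (u r : ℂ) * Complex.exp (Complex.I * (ϑ : ℂ)), (v r : ℂ)]

end

/-! The ansatz with `u = r w` turns the Dirac equation into a singular planar system for `(u, v)`.
Rescaling radius and amplitude normalises `v 0 = 1` and moves the shooting freedom from the initial
value into a parameter `ε ∈ (0, 1]`: with `α = (m + ω) / (m - ω)` and `β = β₂ / β₁` the system is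
`u' + u/r = v (v² + 2βu² - ε)`, `v' = -u (εα + u² + 2βv²)`. It is Hamiltonian apart from the
friction term `u/r`, so the energy `radialEnergy` decreases along solutions; this bounds them and
makes them global.

Two sets of parameters compete: those whose energy becomes negative while `v` is still positive, and
those whose `v` becomes negative. Both are open by continuous dependence. They are disjoint, since
`v` cannot vanish where the energy is negative. The value `ε = 1` is in the first set, because its
initial energy is already negative. Small `ε` are not. At `ε = 0` the solution is explicit, and the
integral `∫ s (αu² - v²) ds` diverges logarithmically to `+∞`, so for small `ε` it is positive at
some fixed radius. If moreover `v` stayed positive, the Pohozaev identity (`IsProfile.pohozaev`) and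
the monotonicity of `u / v` would keep the energy positive from there on
(`IsProfile.energy_pos_of_pohozaevIntegral_pos`), which excludes the first set. Connectedness of
`(0, 1]` gives an `ε` in neither set (`exists_localized_profile`).

For that `ε`, `v > 0` and the energy is nonnegative forever. Then `u > 0` away from the origin, `v`
decreases, both components tend to zero, and near the rest point the sign of the energy makes `v` at
most a multiple of `u`, which yields exponential decay (`IsProfile.exponential_decay`). Smoothness
on the plane holds because `w` and `v` extend to smooth even functions on the line. -/

open Set Filter Topology

/-! ### Global solvability of averaged Volterra equations -/

theorem mul_exp_neg_le {K : ℝ} (hK : 0 < K) (r : ℝ) : r * Real.exp (-(K * r)) ≤ 1 / K := by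
  rw [Real.exp_neg, ← div_eq_mul_inv, div_le_div_iff₀ (Real.exp_pos _) hK]
  nlinarith [Real.add_one_le_exp (K * r)]

theorem integral_mul_exp {K r : ℝ} (hK : 0 < K) :
    ∫ τ in (0 : ℝ)..1, r * Real.exp (K * (r * τ)) = (Real.exp (K * r) - 1) / K := by
  have h : ∀ τ ∈ uIcc (0 : ℝ) 1,
      HasDerivAt (fun τ => Real.exp (K * (r * τ)) / K) (r * Real.exp (K * (r * τ))) τ := by
    intro τ _
    have := ((((hasDerivAt_id τ).const_mul r).const_mul K).exp).div_const K
    refine this.congr_deriv ?_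
    simp only [id]
    field_simp
  rw [intervalIntegral.integral_eq_sub_of_hasDerivAt h
    (Continuous.intervalIntegrable (by fun_prop) _ _)]
  simp [sub_div]

/-- Unique solvability of the averaged Volterra equation `x(r) = x₀ + r ∫₀¹ g(τ, x(rτ)) dτ`
for Lipschitz bounded `g`, with continuous dependence on a real parameter. -/
theorem exists_averaged_volterra {E : Type*} [NormedAddCommGroup E] [NormedSpace ℝ E]
    [CompleteSpace E] (g : ℝ → ℝ → E → E) (x₀ : E) {L : ℝ} (hL : 0 < L)
    (hcont : ∀ ε, Continuous fun p : ℝ × E => g ε p.1 p.2)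
    (hbound : ∀ ε, ∀ τ ∈ Icc (0 : ℝ) 1, ∀ x, ‖g ε τ x‖ ≤ L)
    (hlip : ∀ ε, ∀ τ ∈ Icc (0 : ℝ) 1, ∀ x y, ‖g ε τ x - g ε τ y‖ ≤ L * ‖x - y‖)
    (hpar : ∀ ε ε', ∀ τ ∈ Icc (0 : ℝ) 1, ∀ x, ‖g ε τ x - g ε' τ x‖ ≤ L * |ε - ε'|) :
    ∃ X : ℝ → ℝ → E, (Continuous fun p : ℝ × ℝ => X p.1 p.2) ∧
      (∀ ε r, X ε r = x₀ + r • ∫ τ in (0 : ℝ)..1, g ε τ (X ε (r * τ))) ∧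
      ∀ ε, ∀ y : ℝ → E, Continuous y →
        (∀ r, y r = x₀ + r • ∫ τ in (0 : ℝ)..1, g ε τ (y (r * τ))) → y = X ε := by
  -- In the norm weighted by `exp (-K |r|)` the integral operator has Lipschitz constant at most `L
  -- / K`; this choice makes it `1 / 2`.
  set K : ℝ := 2 * L with hKdef
  have hK : 0 < K := by positivity
  have hint : ∀ ε (y : ℝ → E), Continuous y → ∀ r,
      IntervalIntegrable (fun τ => g ε τ (y (r * τ))) MeasureTheory.volume 0 1 := by
    intro ε y hy r
    apply Continuous.intervalIntegrable
    exact (hcont ε).comp (continuous_id.prodMk (hy.comp (continuous_const.mul continuous_id)))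
  have hTcont : ∀ ε (y : ℝ → E), Continuous y →
      Continuous fun r : ℝ => x₀ + r • ∫ τ in (0 : ℝ)..1, g ε τ (y (r * τ)) := by
    intro ε y hy
    refine continuous_const.add (continuous_id.smul ?_)
    apply intervalIntegral.continuous_parametric_intervalIntegral_of_continuous'
    exact (hcont ε).comp (continuous_snd.prodMk (hy.comp (continuous_fst.mul continuous_snd)))
  have hTbound : ∀ ε (y : ℝ → E), ∀ r,
      ‖Real.exp (-(K * |r|)) • (x₀ + r • ∫ τ in (0 : ℝ)..1, g ε τ (y (r * τ)))‖
        ≤ ‖x₀‖ + L * (1 / K) := by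
    intro ε y r
    have h1 : ‖∫ τ in (0 : ℝ)..1, g ε τ (y (r * τ))‖ ≤ L := by
      have := intervalIntegral.norm_integral_le_of_norm_le_const (a := (0 : ℝ)) (b := 1)
        (f := fun τ => g ε τ (y (r * τ))) (C := L) (by
          intro τ hτ
          rw [uIoc_of_le zero_le_one] at hτ
          exact hbound ε τ ⟨hτ.1.le, hτ.2⟩ _)
      simpa using this
    have h2 : Real.exp (-(K * |r|)) ≤ 1 := by
      rw [Real.exp_le_one_iff]; have := abs_nonneg r; nlinarith [mul_nonneg hK.le this]
    have h3 := mul_exp_neg_le hK |r|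
    calc ‖Real.exp (-(K * |r|)) • (x₀ + r • ∫ τ in (0 : ℝ)..1, g ε τ (y (r * τ)))‖
        ≤ Real.exp (-(K * |r|)) * (‖x₀‖ + |r| * L) := by
          rw [norm_smul, Real.norm_of_nonneg (Real.exp_pos _).le]
          gcongr
          refine (norm_add_le _ _).trans ?_
          rw [norm_smul, Real.norm_eq_abs]
          gcongr
      _ = Real.exp (-(K * |r|)) * ‖x₀‖ + L * (|r| * Real.exp (-(K * |r|))) := by ring
      _ ≤ 1 * ‖x₀‖ + L * (1 / K) := by gcongr
      _ = _ := by rw [one_mul]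
  have hunw : ∀ φ : BoundedContinuousFunction ℝ E,
      Continuous fun r => Real.exp (K * |r|) • φ r := by
    intro φ
    exact (by fun_prop : Continuous fun r : ℝ => Real.exp (K * |r|)).smul φ.continuous
  -- The operator is conjugated by the weight, so that the weighted norm becomes the ordinary sup
  -- norm on bounded continuous functions.
  let S : ℝ → BoundedContinuousFunction ℝ E → BoundedContinuousFunction ℝ E := fun ε φ =>
    BoundedContinuousFunction.ofNormedAddCommGroup
      (fun r => Real.exp (-(K * |r|)) • (x₀ + r • ∫ τ in (0 : ℝ)..1,
        g ε τ (Real.exp (K * |r * τ|) • φ (r * τ))))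
      ((by fun_prop : Continuous fun r : ℝ => Real.exp (-(K * |r|))).smul
        (hTcont ε _ (hunw φ))) (‖x₀‖ + L * (1 / K)) (hTbound ε fun r => Real.exp (K * |r|) • φ r)
  have hSapply : ∀ ε φ r, S ε φ r = Real.exp (-(K * |r|)) • (x₀ + r • ∫ τ in (0 : ℝ)..1,
        g ε τ (Real.exp (K * |r * τ|) • φ (r * τ))) := fun _ _ _ => rfl
  have hdiff : ∀ a b c : E, ∀ s : ℝ, ∀ r : ℝ, dist (s • (c + r • a)) (s • (c + r • b)) =
      |s| * (|r| * ‖a - b‖) := by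
    intro a b c s r
    rw [dist_eq_norm, ← smul_sub, add_sub_add_left_eq_sub, ← smul_sub, norm_smul, norm_smul,
      Real.norm_eq_abs, Real.norm_eq_abs]
  have hcontr : ∀ ε, ContractingWith (1 / 2) (S ε) := by
    intro ε
    refine ⟨by rw [← NNReal.coe_lt_coe]; norm_num, LipschitzWith.of_dist_le_mul fun φ ψ => ?_⟩
    rw [BoundedContinuousFunction.dist_le (by positivity)]
    intro r
    rw [hSapply, hSapply, hdiff, ← intervalIntegral.integral_sub (hint ε _ (hunw φ) r)
      (hint ε _ (hunw ψ) r), abs_of_pos (Real.exp_pos _)]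
    have h1 : ‖∫ τ in (0 : ℝ)..1, (g ε τ (Real.exp (K * |r * τ|) • φ (r * τ)) -
        g ε τ (Real.exp (K * |r * τ|) • ψ (r * τ)))‖
        ≤ ∫ τ in (0 : ℝ)..1, L * dist φ ψ * Real.exp (K * (|r| * τ)) := by
      apply intervalIntegral.norm_integral_le_of_norm_le zero_le_one
      · refine MeasureTheory.ae_of_all _ fun τ hτ => ?_
        refine (hlip ε τ ⟨hτ.1.le, hτ.2⟩ _ _).trans ?_
        rw [← smul_sub, norm_smul, Real.norm_of_nonneg (Real.exp_pos _).le, abs_mul,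
          abs_of_pos hτ.1, ← dist_eq_norm]
        have := BoundedContinuousFunction.dist_coe_le_dist (f := φ) (g := ψ) (r * τ)
        calc L * (Real.exp (K * (|r| * τ)) * dist (φ (r * τ)) (ψ (r * τ)))
            ≤ L * (Real.exp (K * (|r| * τ)) * dist φ ψ) := by gcongr
          _ = _ := by ring
      · exact Continuous.intervalIntegrable (by fun_prop) _ _
    have h2 : |r| * (∫ τ in (0 : ℝ)..1, L * dist φ ψ * Real.exp (K * (|r| * τ))) =
        L * dist φ ψ * ((Real.exp (K * |r|) - 1) / K) := by
      rw [← integral_mul_exp (r := |r|) hK, ← intervalIntegral.integral_const_mul,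
        ← intervalIntegral.integral_const_mul]
      congr 1; ext τ; ring
    calc Real.exp (-(K * |r|)) * (|r| * _)
        ≤ Real.exp (-(K * |r|)) * (L * dist φ ψ * ((Real.exp (K * |r|) - 1) / K)) := by
          rw [← h2]; gcongr
      _ = (1 - Real.exp (-(K * |r|))) * (dist φ ψ / 2) := by
          rw [Real.exp_neg, hKdef]; field_simp
      _ ≤ 1 * (dist φ ψ / 2) := by
          gcongr; linarith [Real.exp_pos (-(K * |r|))]
      _ = _ := by push_cast; ring
  have hSpar : ∀ ε ε' φ, dist (S ε φ) (S ε' φ) ≤ L * (1 / K) * |ε - ε'| := by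
    intro ε ε' φ
    rw [BoundedContinuousFunction.dist_le (by positivity)]
    intro r
    rw [hSapply, hSapply, hdiff, ← intervalIntegral.integral_sub (hint ε _ (hunw φ) r)
      (hint ε' _ (hunw φ) r), abs_of_pos (Real.exp_pos _)]
    have h1 := intervalIntegral.norm_integral_le_of_norm_le_const (a := (0 : ℝ)) (b := 1)
        (f := fun τ => g ε τ (Real.exp (K * |r * τ|) • φ (r * τ)) -
          g ε' τ (Real.exp (K * |r * τ|) • φ (r * τ))) (C := L * |ε - ε'|) (by
          intro τ hτ
          rw [uIoc_of_le zero_le_one] at hτ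
          exact hpar ε ε' τ ⟨hτ.1.le, hτ.2⟩ _)
    rw [sub_zero, abs_one, mul_one] at h1
    have h3 := mul_exp_neg_le hK |r|
    calc Real.exp (-(K * |r|)) * (|r| * _)
        ≤ Real.exp (-(K * |r|)) * (|r| * (L * |ε - ε'|)) := by gcongr
      _ = L * (|r| * Real.exp (-(K * |r|))) * |ε - ε'| := by ring
      _ ≤ _ := by gcongr
  let Φ : ℝ → BoundedContinuousFunction ℝ E := fun ε => (hcontr ε).fixedPoint (S ε)
  have hΦ : ∀ ε, S ε (Φ ε) = Φ ε := fun ε => (hcontr ε).fixedPoint_isFixedPt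
  -- Fixed points of uniform contractions that are Lipschitz in the parameter are themselves
  -- Lipschitz in it.
  have hΦcont : Continuous Φ := by
    apply LipschitzWith.continuous (K := Real.toNNReal (L * (1 / K) / (1 - (1 / 2 : NNReal))))
    apply LipschitzWith.of_dist_le_mul
    intro ε ε'
    have := (hcontr ε).fixedPoint_lipschitz_in_map (hcontr ε') (hSpar ε ε')
    refine this.trans ?_
    rw [Real.coe_toNNReal _ (by push_cast; norm_num; positivity), Real.dist_eq]
    apply le_of_eq; ring
  have hexp : ∀ (t : ℝ) (z : E), Real.exp t • (Real.exp (-t) • z) = z := by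
    intro t z
    rw [smul_smul, ← Real.exp_add]; simp
  refine ⟨fun ε r => Real.exp (K * |r|) • Φ ε r, ?_, ?_, ?_⟩
  · have h1 : Continuous fun p : ℝ × ℝ => Φ p.1 p.2 :=
      (hΦcont.comp continuous_fst).eval continuous_snd
    exact (by fun_prop : Continuous fun p : ℝ × ℝ => Real.exp (K * |p.2|)).smul h1
  · intro ε r
    beta_reduce
    conv_lhs => rw [← hΦ ε, hSapply, hexp]
  · intro ε y hy hfix
    let φ : BoundedContinuousFunction ℝ E := BoundedContinuousFunction.ofNormedAddCommGroup
      (fun r => Real.exp (-(K * |r|)) • y r)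
      ((by fun_prop : Continuous fun r : ℝ => Real.exp (-(K * |r|))).smul hy)
      (‖x₀‖ + L * (1 / K)) (fun r => by rw [hfix r]; exact hTbound ε y r)
    have hφ : ∀ r, φ r = Real.exp (-(K * |r|)) • y r := fun _ => rfl
    have hφfix : S ε φ = φ := by
      ext r
      rw [hSapply, hφ]
      conv_rhs => rw [hfix r]
      simp only [hφ, hexp]
    have : φ = Φ ε := (hcontr ε).fixedPoint_unique hφfix
    ext r
    beta_reduce
    rw [← this, hφ, hexp]

/-! ### Radial averages and smooth functions of the norm -/

/-- The weighted radial average `∫₀¹ τʲ f(rτ) dτ`. -/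
noncomputable def radialAvg (j : ℕ) (f : ℝ → ℝ) (r : ℝ) : ℝ :=
  ∫ τ in (0 : ℝ)..1, τ ^ j * f (r * τ)

theorem continuous_radialAvg {j : ℕ} {f : ℝ → ℝ} (hf : Continuous f) :
    Continuous (radialAvg j f) := by
  apply intervalIntegral.continuous_parametric_intervalIntegral_of_continuous'
  fun_prop

theorem hasDerivAt_radialAvg {j : ℕ} {f : ℝ → ℝ} (hf : ContDiff ℝ 1 f) (r : ℝ) :
    HasDerivAt (radialAvg j f) (radialAvg (j + 1) (deriv f) r) r := by
  have hf' : Continuous (deriv f) := hf.continuous_deriv le_rfl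
  obtain ⟨C, hC⟩ := (isCompact_Icc (a := -(|r| + 1)) (b := |r| + 1)).exists_bound_of_continuousOn
    hf'.continuousOn
  refine (intervalIntegral.hasDerivAt_integral_of_dominated_loc_of_deriv_le
    (F := fun r τ => τ ^ j * f (r * τ)) (F' := fun r τ => τ ^ (j + 1) * deriv f (r * τ))
    (bound := fun _ => C) (s := Metric.ball r 1) (Metric.ball_mem_nhds r one_pos)
    (Eventually.of_forall fun x => ?_) ?_ ?_ ?_ ?_ ?_).2
  · exact (by have := hf.continuous; fun_prop :
      Continuous fun τ => τ ^ j * f (x * τ)).aestronglyMeasurable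
  · exact (by have := hf.continuous; fun_prop :
      Continuous fun τ => τ ^ j * f (r * τ)).intervalIntegrable _ _
  · exact (by fun_prop :
      Continuous fun τ => τ ^ (j + 1) * deriv f (r * τ)).aestronglyMeasurable
  · refine MeasureTheory.ae_of_all _ fun τ hτ x hx => ?_
    rw [uIoc_of_le zero_le_one] at hτ
    have hx' : |x| ≤ |r| + 1 := by
      have h1 : |x - r| < 1 := by simpa [Real.dist_eq] using hx
      have h2 := abs_sub_abs_le_abs_sub x r
      linarith
    have h3 : |x * τ| ≤ |r| + 1 := by
      rw [abs_mul, abs_of_pos hτ.1]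
      nlinarith [abs_nonneg x, hτ.2]
    have h4 := hC (x * τ) (abs_le.1 h3)
    rw [norm_mul, norm_pow, Real.norm_of_nonneg hτ.1.le]
    calc τ ^ (j + 1) * ‖deriv f (x * τ)‖ ≤ 1 * ‖deriv f (x * τ)‖ := by
          gcongr; exact pow_le_one₀ hτ.1.le hτ.2
      _ ≤ C := by linarith
  · exact intervalIntegrable_const
  · refine MeasureTheory.ae_of_all _ fun τ _ x _ => ?_
    have h1 := ((hf.differentiable one_ne_zero (x * τ)).hasDerivAt.comp x
      ((hasDerivAt_id x).mul_const τ)).const_mul (τ ^ j)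
    refine h1.congr_deriv ?_
    ring

/-- Each derivative falls on `f` and raises the weight exponent by one, so the induction on `n` runs
over all `j` at once. -/
theorem contDiff_radialAvg {n : ℕ} : ∀ {j : ℕ} {f : ℝ → ℝ}, ContDiff ℝ n f →
    ContDiff ℝ n (radialAvg j f) := by
  induction n with
  | zero =>
    intro j f hf
    exact contDiff_zero.2 (continuous_radialAvg (contDiff_zero.1 hf))
  | succ n ih =>
    intro j f hf
    have h1 : ContDiff ℝ 1 f := hf.of_le (by norm_cast; omega)
    have hd := fun r => hasDerivAt_radialAvg (j := j) h1 r
    push_cast at hf ⊢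
    rw [contDiff_succ_iff_deriv] at hf ⊢
    refine ⟨fun r => (hd r).differentiableAt, by simp, ?_⟩
    rw [show deriv (radialAvg j f) = _ from funext fun r => (hd r).deriv]
    exact ih hf.2.2

/-- `(r² ∫₀¹ τ f(rτ) dτ)' = r f(r)`, in integral form. -/
theorem sq_mul_radialAvg_one {f : ℝ → ℝ} (r : ℝ) :
    r ^ 2 * radialAvg 1 f r = ∫ s in (0 : ℝ)..r, s * f s := by
  have := intervalIntegral.smul_integral_comp_mul_left (fun s => s * f s) r (a := 0) (b := 1)
  rw [mul_zero, mul_one] at this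
  rw [← this, radialAvg, smul_eq_mul, sq, mul_assoc, ← intervalIntegral.integral_const_mul]
  congr 2; ext τ; ring

theorem mul_radialAvg_zero {f : ℝ → ℝ} (r : ℝ) :
    r * radialAvg 0 f r = ∫ s in (0 : ℝ)..r, f s := by
  have := intervalIntegral.smul_integral_comp_mul_left f r (a := 0) (b := 1)
  rw [mul_zero, mul_one] at this
  rw [← this, radialAvg, smul_eq_mul]
  simp

theorem hasDerivAt_mul_radialAvg_zero {f : ℝ → ℝ} (hf : Continuous f) (r : ℝ) :
    HasDerivAt (fun r => r * radialAvg 0 f r) (f r) r := by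
  simp only [mul_radialAvg_zero]
  exact intervalIntegral.integral_hasDerivAt_right (hf.intervalIntegrable _ _)
    (hf.stronglyMeasurableAtFilter _ _) hf.continuousAt

theorem radialAvg_apply_zero {j : ℕ} {f : ℝ → ℝ} :
    radialAvg j f 0 = f 0 / (j + 1) := by
  simp [radialAvg, integral_pow, div_eq_inv_mul]

/-- The function `r ∫₀¹ τ f(rτ) dτ` solves `u' + u / r = f`. -/
theorem hasDerivAt_mul_radialAvg_one {f : ℝ → ℝ} (hf : Continuous f) (r : ℝ) :
    HasDerivAt (fun r => r * radialAvg 1 f r) (f r - radialAvg 1 f r) r := by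
  have hc := continuous_radialAvg (j := 1) hf
  rcases eq_or_ne r 0 with rfl | hr
  · rw [hasDerivAt_iff_tendsto_slope_zero]
    have h0 : f 0 - radialAvg 1 f 0 = radialAvg 1 f 0 := by
      rw [radialAvg_apply_zero]; push_cast; ring
    rw [h0]
    refine ((hc.tendsto 0).mono_left nhdsWithin_le_nhds).congr' ?_
    filter_upwards [self_mem_nhdsWithin] with t ht
    have ht' : t ≠ 0 := ht
    simp only [zero_add, zero_mul, sub_zero, smul_eq_mul]
    field_simp
  · have h1 : HasDerivAt (fun r => ∫ s in (0 : ℝ)..r, s * f s) (r * f r) r := by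
      have hcont : Continuous fun s => s * f s := by fun_prop
      exact intervalIntegral.integral_hasDerivAt_right (hcont.intervalIntegrable _ _)
        (hcont.stronglyMeasurableAtFilter _ _) hcont.continuousAt
    have h2 := h1.div (hasDerivAt_id r) hr
    have h3 : (fun r => r * radialAvg 1 f r) =ᶠ[𝓝 r]
        fun r => (∫ s in (0 : ℝ)..r, s * f s) / id r := by
      filter_upwards [eventually_ne_nhds hr] with t ht
      rw [← sq_mul_radialAvg_one, id, sq]; field_simp
    refine (h2.congr_of_eventuallyEq h3).congr_deriv ?_
    simp only [id, ← sq_mul_radialAvg_one]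
    field_simp

/-- Writing `f' = r g` for a smooth even function `f`, with `g` smooth and even. -/
theorem exists_deriv_eq_mul_of_even {f : ℝ → ℝ} (hf : ContDiff ℝ (⊤ : ℕ∞) f)
    (heven : ∀ r, f (-r) = f r) :
    ∃ g : ℝ → ℝ, ContDiff ℝ (⊤ : ℕ∞) g ∧ (∀ r, g (-r) = g r) ∧ ∀ r, deriv f r = r * g r := by
  have hf1 : ContDiff ℝ (⊤ : ℕ∞) (deriv f) := hf.deriv'
  have hf2 : ContDiff ℝ (⊤ : ℕ∞) (deriv (deriv f)) := hf1.deriv'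
  have hodd : ∀ r, deriv f (-r) = -deriv f r := by
    intro r
    have h := deriv_comp_neg f r
    rw [funext heven] at h
    linarith
  have heven2 : ∀ r, deriv (deriv f) (-r) = deriv (deriv f) r := by
    intro r
    have h := deriv_comp_neg (deriv f) r
    rw [funext hodd, deriv.fun_neg] at h
    linarith
  refine ⟨radialAvg 0 (deriv (deriv f)), ?_, ?_, ?_⟩
  · exact contDiff_infty.2 fun n => contDiff_radialAvg (contDiff_infty.1 hf2 n)
  · intro r
    simp only [radialAvg, neg_mul, heven2]
  · intro r
    rw [mul_radialAvg_zero, intervalIntegral.integral_deriv_eq_sub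
      (fun x _ => hf1.differentiable (by simp) x) (hf2.continuous.intervalIntegrable _ _)]
    have := hodd 0
    rw [neg_zero] at this
    linarith

/-- The factor `r` in `f' = r g` cancels the singular `1 / ‖x‖` in the derivative of the norm. At
the origin it gives `f' 0 = 0`, hence a vanishing differential. -/
theorem hasFDerivAt_comp_norm {F : Type*} [NormedAddCommGroup F] [InnerProductSpace ℝ F]
    {f g : ℝ → ℝ} (hf : Differentiable ℝ f) (h : ∀ r, deriv f r = r * g r)
    (x : F) : HasFDerivAt (fun x : F => f ‖x‖) (g ‖x‖ • innerSL ℝ x) x := by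
  rcases eq_or_ne x 0 with rfl | hx
  · have h0 : HasDerivAt f 0 0 := by
      have := (hf 0).hasDerivAt
      rwa [h, zero_mul] at this
    rw [hasFDerivAt_iff_isLittleO_nhds_zero]
    rw [hasDerivAt_iff_isLittleO_nhds_zero] at h0
    have h1 := h0.comp_tendsto (tendsto_norm_zero (E := F))
    simp only [Function.comp_def] at h1
    simpa using h1.of_norm_right
  · have hn := (hasStrictFDerivAt_norm_sq x).hasFDerivAt.sqrt (by simpa using hx)
    simp only [Real.sqrt_sq (norm_nonneg _)] at hn
    refine ((hf ‖x‖).hasDerivAt.comp_hasFDerivAt x hn).congr_fderiv ?_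
    have hx' : ‖x‖ ≠ 0 := norm_ne_zero_iff.2 hx
    rw [h]
    ext y
    simp
    field_simp

/-- The differential at `x` is `g ‖x‖` times the inner product with `x`, where `g` is again smooth
and even, so the induction closes. -/
theorem contDiff_comp_norm_of_even {F : Type*} [NormedAddCommGroup F] [InnerProductSpace ℝ F]
    {f : ℝ → ℝ} (hf : ContDiff ℝ (⊤ : ℕ∞) f) (heven : ∀ r, f (-r) = f r) :
    ContDiff ℝ (⊤ : ℕ∞) fun x : F => f ‖x‖ := by
  refine contDiff_infty.2 fun n => ?_
  induction n generalizing f with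
  | zero => exact contDiff_zero.2 (hf.continuous.comp continuous_norm)
  | succ n ih =>
    obtain ⟨g, hg, hgeven, hfg⟩ := exists_deriv_eq_mul_of_even hf heven
    have hd := hasFDerivAt_comp_norm (F := F) (hf.differentiable (by simp)) hfg
    push_cast
    rw [contDiff_succ_iff_fderiv]
    refine ⟨fun x => (hd x).differentiableAt, by simp, ?_⟩
    rw [show fderiv ℝ (fun x : F => f ‖x‖) = _ from funext fun x => (hd x).fderiv]
    exact (ih hg hgeven).smul (innerSL ℝ).contDiff

/-- Serves all the continuation arguments below: a bound or a sign is followed up to the first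
radius where it could fail. -/
theorem exists_first_zero {f : ℝ → ℝ} {a b : ℝ} (hab : a ≤ b) (hf : ContinuousOn f (Icc a b))
    (ha : 0 < f a) (hb : f b ≤ 0) : ∃ c ∈ Ioc a b, f c = 0 ∧ ∀ x ∈ Ico a c, 0 < f x := by
  let s : Set ℝ := {x ∈ Icc a b | f x ≤ 0}
  have hs : IsCompact s := by
    have : IsClosed s := hf.preimage_isClosed_of_isClosed isClosed_Icc isClosed_Iic
    exact isCompact_Icc.of_isClosed_subset this fun x hx => hx.1
  have hne : s.Nonempty := ⟨b, ⟨hab, le_rfl⟩, hb⟩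
  have hc := hs.sInf_mem hne
  set c := sInf s
  have hlt : ∀ x ∈ Ico a c, 0 < f x := by
    intro x hx
    by_contra hcon
    have : x ∈ s := ⟨⟨hx.1, hx.2.le.trans hc.1.2⟩, not_lt.1 hcon⟩
    exact absurd (csInf_le hs.bddBelow this) (not_le.2 hx.2)
  have hac : a < c := by
    refine lt_of_le_of_ne hc.1.1 fun h => ?_
    have := hc.2
    rw [← h] at this
    linarith
  refine ⟨c, ⟨hac, hc.1.2⟩, le_antisymm hc.2 ?_, hlt⟩
  have hcl : c ∈ closure (Ico a c) := by rw [closure_Ico hac.ne]; exact ⟨hac.le, le_rfl⟩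
  have hcont : ContinuousWithinAt f (Ico a c) c :=
    (hf c hc.1).mono fun x hx => ⟨hx.1, hx.2.le.trans hc.1.2⟩
  have := mem_closure_iff_nhdsWithin_neBot.1 hcl
  exact ge_of_tendsto hcont (eventually_nhdsWithin_of_forall fun x hx => (hlt x hx).le)

/-! ### Reduction of the Dirac equation to the radial system -/

/-- The gradient of `G`, computed. -/
noncomputable def gradPotential (β₁ β₂ : ℝ) (z : Spinor) : Spinor :=
  !₂[(β₁ * ‖z 0‖ ^ 2 + 2 * β₂ * ‖z 1‖ ^ 2) • z 0, (β₁ * ‖z 1‖ ^ 2 + 2 * β₂ * ‖z 0‖ ^ 2) • z 1]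

theorem hasFDerivAt_norm_sq_coord (i : Fin 2) (z : Spinor) :
    HasFDerivAt (fun z : Spinor => ‖z i‖ ^ 2)
      ((2 : ℝ) • (innerSL ℝ (z i)).comp ((EuclideanSpace.proj i : Spinor →L[ℂ] ℂ).restrictScalars ℝ))
      z := by
  have h1 : HasFDerivAt (fun z : Spinor => z i)
      ((EuclideanSpace.proj i : Spinor →L[ℂ] ℂ).restrictScalars ℝ) z :=
    ((EuclideanSpace.proj i : Spinor →L[ℂ] ℂ).restrictScalars ℝ).hasFDerivAt
  have h2 := (hasStrictFDerivAt_norm_sq (z i)).hasFDerivAt.comp z h1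
  refine h2.congr_fderiv ?_
  ext y
  simp
  ring

theorem gradient_potentialG (β₁ β₂ : ℝ) (z : Spinor) :
    gradient (𝕜 := ℝ) (potentialG β₁ β₂) z = gradPotential β₁ β₂ z := by
  refine HasGradientAt.gradient ?_
  rw [hasGradientAt_iff_hasFDerivAt]
  have h0 := hasFDerivAt_norm_sq_coord 0 z
  have h1 := hasFDerivAt_norm_sq_coord 1 z
  have h := (((h0.pow 2).add (h1.pow 2)).const_mul (β₁ / 4)).add ((h0.const_mul β₂).mul h1)
  refine (h.congr_of_eventuallyEq (Eventually.of_forall fun y => ?_)).congr_fderiv ?_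
  · simp only [potentialG, Pi.add_apply, Pi.mul_apply]; ring
  · ext y
    simp [gradPotential, PiLp.inner_apply, Complex.inner, Complex.smul_re, Complex.smul_im,
      -Complex.real_smul]
    ring

/-- The spinor field `(i w(|x|) (x₁ + i x₂), v(|x|))`. -/
noncomputable def profileSpinor (w v : ℝ → ℝ) (x : Plane) : Spinor :=
  !₂[Complex.I * ((w ‖x‖ : ℂ) * ((x 0 : ℂ) + Complex.I * (x 1 : ℂ))), (v ‖x‖ : ℂ)]

theorem contDiff_profileSpinor {w v : ℝ → ℝ} (hw : ContDiff ℝ (⊤ : ℕ∞) w)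
    (hv : ContDiff ℝ (⊤ : ℕ∞) v) (hwe : ∀ r, w (-r) = w r) (hve : ∀ r, v (-r) = v r) :
    ContDiff ℝ (⊤ : ℕ∞) (profileSpinor w v) := by
  have h0 := contDiff_comp_norm_of_even (F := Plane) hw hwe
  have h1 := contDiff_comp_norm_of_even (F := Plane) hv hve
  have hr : ∀ {f : Plane → ℝ}, ContDiff ℝ (⊤ : ℕ∞) f →
      ContDiff ℝ (⊤ : ℕ∞) fun x => (f x : ℂ) := fun hf => Complex.ofRealCLM.contDiff.comp hf
  have hc : ∀ i : Fin 2, ContDiff ℝ (⊤ : ℕ∞) fun x : Plane => (x i : ℂ) := fun i =>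
    hr (EuclideanSpace.proj i : Plane →L[ℝ] ℝ).contDiff
  rw [contDiff_piLp]
  intro i
  fin_cases i
  · exact contDiff_const.mul ((hr h0).mul ((hc 0).add (contDiff_const.mul (hc 1))))
  · exact hr h1

theorem hasFDerivAt_ofReal_comp {f : Plane → ℝ} {f' : Plane →L[ℝ] ℝ} {x : Plane}
    (h : HasFDerivAt f f' x) : HasFDerivAt (fun x => (f x : ℂ)) (Complex.ofRealCLM.comp f') x :=
  Complex.ofRealCLM.hasFDerivAt.comp x h

theorem partialDeriv_apply {ψ : Plane → Spinor} (hψ : Differentiable ℝ ψ) (i j : Fin 2)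
    (x : Plane) {L : Plane →L[ℝ] ℂ} (hL : HasFDerivAt (fun x => ψ x i) L x) :
    partialDeriv j ψ x i = L (EuclideanSpace.single j 1) := by
  have h1 := ((EuclideanSpace.proj i : Spinor →L[ℂ] ℂ).restrictScalars ℝ).hasFDerivAt.comp x
    (hψ x).hasFDerivAt
  rw [hL.unique h1]
  rfl

theorem partialDeriv_profileSpinor {w v g k : ℝ → ℝ} (hw : ContDiff ℝ (⊤ : ℕ∞) w)
    (hv : ContDiff ℝ (⊤ : ℕ∞) v) (hwe : ∀ r, w (-r) = w r) (hve : ∀ r, v (-r) = v r)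
    (hg : ∀ r, deriv w r = r * g r) (hk : ∀ r, deriv v r = r * k r) (j : Fin 2) (x : Plane) :
    partialDeriv j (profileSpinor w v) x 0 =
      Complex.I * ((g ‖x‖ * x j : ℝ) * ((x 0 : ℂ) + Complex.I * (x 1 : ℂ)) +
        (w ‖x‖ : ℂ) * (if j = 0 then 1 else Complex.I)) ∧
    partialDeriv j (profileSpinor w v) x 1 = (k ‖x‖ * x j : ℝ) := by
  have hd : Differentiable ℝ (profileSpinor w v) :=
    (contDiff_profileSpinor hw hv hwe hve).differentiable (by simp)
  have h0 := hasFDerivAt_ofReal_comp (hasFDerivAt_comp_norm (hw.differentiable (by simp)) hg x)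
  have h1 := hasFDerivAt_ofReal_comp (hasFDerivAt_comp_norm (hv.differentiable (by simp)) hk x)
  have hc : ∀ i : Fin 2, HasFDerivAt (fun x : Plane => (x i : ℂ))
      (Complex.ofRealCLM.comp (EuclideanSpace.proj i : Plane →L[ℝ] ℝ)) x := fun i =>
    hasFDerivAt_ofReal_comp (EuclideanSpace.proj i : Plane →L[ℝ] ℝ).hasFDerivAt
  have h2 := (h0.mul ((hc 0).add ((hc 1).const_mul Complex.I))).const_mul Complex.I
  have hin : inner ℝ x (EuclideanSpace.single j (1 : ℝ)) = x j := by
    simp [EuclideanSpace.inner_single_right]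
  constructor
  · rw [partialDeriv_apply hd 0 j x h2]
    fin_cases j <;> simp <;> simp_all <;> ring
  · rw [partialDeriv_apply hd 1 j x h1]
    simp [hin]

/-- With `u = r w` one has `u' + u / r = r w' + 2 w`, so the hypotheses involve no division at the
origin. Writing `w' = r g` and `v' = r k` makes both spinor components polynomial identities in `x
0`, `x 1`. -/
theorem isStationarySolution_profileSpinor {m ω β₁ β₂ : ℝ} {w v : ℝ → ℝ}
    (hw : ContDiff ℝ (⊤ : ℕ∞) w) (hv : ContDiff ℝ (⊤ : ℕ∞) v)
    (hwe : ∀ r, w (-r) = w r) (hve : ∀ r, v (-r) = v r)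
    (hw' : ∀ r, 0 ≤ r → r * deriv w r + 2 * w r =
      v r * (β₁ * v r ^ 2 + 2 * β₂ * (r * w r) ^ 2 - (m - ω)))
    (hv' : ∀ r, 0 ≤ r → deriv v r =
      -(r * w r) * ((m + ω) + β₁ * (r * w r) ^ 2 + 2 * β₂ * v r ^ 2)) :
    IsStationarySolution m ω β₁ β₂ (profileSpinor w v) := by
  obtain ⟨g, hgs, -, hg⟩ := exists_deriv_eq_mul_of_even hw hwe
  obtain ⟨k, hks, -, hk⟩ := exists_deriv_eq_mul_of_even hv hve
  -- The relation `v' = r k` determines `k` only where `r > 0`; continuity carries the formula to `r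
  -- = 0`.
  have hkc : ∀ r, 0 ≤ r → k r = -w r * ((m + ω) + β₁ * (r * w r) ^ 2 + 2 * β₂ * v r ^ 2) := by
    intro r hr
    have hcl : r ∈ closure (Ioi (0 : ℝ)) := by rw [closure_Ioi]; exact hr
    have hwc := hw.continuous
    have hvc := hv.continuous
    have hkc := hks.continuous
    refine closure_minimal (fun s (hs : 0 < s) => ?_) (isClosed_eq hkc
      (by fun_prop : Continuous fun r => -w r *
        ((m + ω) + β₁ * (r * w r) ^ 2 + 2 * β₂ * v r ^ 2))) hcl
    have := hv' s hs.le
    rw [hk] at this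
    apply mul_left_cancel₀ hs.ne'
    rw [this]; ring
  intro x
  rw [gradient_potentialG]
  have hp := partialDeriv_profileSpinor hw hv hwe hve hg hk
  have hnx : ‖x‖ ^ 2 = x 0 ^ 2 + x 1 ^ 2 := by
    rw [EuclideanSpace.norm_sq_eq]; simp
  have e0 : ‖profileSpinor w v x 0‖ ^ 2 = (‖x‖ * w ‖x‖) ^ 2 := by
    rw [mul_pow, hnx, Complex.sq_norm, Complex.normSq_apply]
    simp [profileSpinor]
    ring
  have e1 : ‖profileSpinor w v x 1‖ ^ 2 = v ‖x‖ ^ 2 := by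
    rw [Complex.sq_norm, Complex.normSq_apply]
    simp [profileSpinor]
    ring
  have hW := hw' ‖x‖ (norm_nonneg x)
  rw [hg, ← mul_assoc, ← sq] at hW
  have hK := hkc ‖x‖ (norm_nonneg x)
  have hWc := congrArg (fun t : ℝ => (t : ℂ)) hW
  have hKc := congrArg (fun t : ℝ => (t : ℂ)) hK
  have hnc := congrArg (fun t : ℝ => (t : ℂ)) hnx
  simp only [Complex.ofReal_mul, Complex.ofReal_add, Complex.ofReal_pow, Complex.ofReal_sub,
    Complex.ofReal_neg, Complex.ofReal_ofNat] at hWc hKc hnc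
  ext i
  fin_cases i
  · simp [diracOp, gradPotential, e0, e1, Matrix.toLpLin_apply, sigma1, sigma2, sigma3,
      dotProduct, (hp 0 x).1, (hp 1 x).1, (hp 0 x).2, (hp 1 x).2]
    simp only [profileSpinor]
    simp
    linear_combination (-(Complex.I * ((x 0 : ℂ) + Complex.I * (x 1 : ℂ)))) * hKc
  · simp [diracOp, gradPotential, e0, e1, Matrix.toLpLin_apply, sigma1, sigma2, sigma3,
      dotProduct, (hp 0 x).1, (hp 1 x).1, (hp 0 x).2, (hp 1 x).2]
    simp only [profileSpinor]
    simp
    linear_combination hWc - (g ‖x‖ : ℂ) * hnc +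
      (-((g ‖x‖ : ℂ) * (x 0 : ℂ) ^ 2 + w ‖x‖) +
        (Complex.I ^ 2 - 1) * ((g ‖x‖ : ℂ) * (x 1 : ℂ) ^ 2 + w ‖x‖)) * Complex.I_sq

theorem hasRadialForm_profileSpinor (w v : ℝ → ℝ) :
    HasRadialForm (fun r => r * w r) v (profileSpinor w v) := by
  intro r hr ϑ
  have hn : ‖(!₂[r * Real.cos ϑ, r * Real.sin ϑ] : Plane)‖ = r := by
    rw [EuclideanSpace.norm_eq, Real.sqrt_eq_iff_mul_self_eq (by positivity) hr]
    simp
    nlinarith [Real.sin_sq_add_cos_sq ϑ]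
  unfold profileSpinor
  rw [hn, mul_comm Complex.I (ϑ : ℂ), Complex.exp_mul_I]
  congr 2
  simp
  ring

theorem norm_profileSpinor_le (w v : ℝ → ℝ) (x : Plane) :
    ‖profileSpinor w v x‖ ≤ |‖x‖ * w ‖x‖| + |v ‖x‖| := by
  have hnx : ‖x‖ ^ 2 = x 0 ^ 2 + x 1 ^ 2 := by
    rw [EuclideanSpace.norm_sq_eq]; simp
  refine abs_le_of_sq_le_sq' ?_ (by positivity) |>.2
  have : ‖profileSpinor w v x‖ ^ 2 = (‖x‖ * w ‖x‖) ^ 2 + v ‖x‖ ^ 2 := by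
    rw [EuclideanSpace.norm_sq_eq, mul_pow, hnx]
    simp [profileSpinor, Complex.sq_norm, Complex.normSq_apply]
    ring
  rw [this, ← sq_abs (‖x‖ * _), ← sq_abs (v ‖x‖)]
  nlinarith [abs_nonneg (‖x‖ * w ‖x‖), abs_nonneg (v ‖x‖),
    mul_nonneg (abs_nonneg (‖x‖ * w ‖x‖)) (abs_nonneg (v ‖x‖))]

/-! ### The rescaled system and its energy -/

/-- `u` and `v` solve the rescaled radial system `u' + u / r = v (v² + 2βu² - ε)`,
`v' = -u (εα + u² + 2βv²)`, `u(0) = 0`, `v(0) = 1`, where `u = r w`. -/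
structure IsProfile (α β ε : ℝ) (u v w : ℝ → ℝ) : Prop where
  contDiff_w : ContDiff ℝ (⊤ : ℕ∞) w
  contDiff_v : ContDiff ℝ (⊤ : ℕ∞) v
  even_w : ∀ r, w (-r) = w r
  even_v : ∀ r, v (-r) = v r
  u_eq : ∀ r, u r = r * w r
  hasDerivAt_u : ∀ r, HasDerivAt u (v r * (v r ^ 2 + 2 * β * u r ^ 2 - ε) - w r) r
  hasDerivAt_v : ∀ r, HasDerivAt v (-(u r * (ε * α + u r ^ 2 + 2 * β * v r ^ 2))) r
  v_zero : v 0 = 1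
  abs_u_le : ∀ r, |u r| ≤ 1
  abs_v_le : ∀ r, |v r| ≤ 1

/-- The energy of the rescaled radial system. -/
noncomputable def radialEnergy (α β ε u v : ℝ) : ℝ :=
  ε * α * u ^ 2 / 2 - ε * v ^ 2 / 2 + (u ^ 4 + v ^ 4) / 4 + β * u ^ 2 * v ^ 2

/-- The Hamiltonian part contributes nothing; friction leaves `-r w² (εα + u² + 2βv²)`. A general
convex `D` is allowed because the truncated system agrees with the true one at first only on an
initial interval. -/
theorem antitoneOn_radialEnergy {α β ε : ℝ} (hα : 0 < α) (hβ : 0 < β) (hε : 0 ≤ ε)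
    {u v w : ℝ → ℝ} {D : Set ℝ} (hD : Convex ℝ D) (hD0 : ∀ r ∈ D, 0 ≤ r)
    (hu0 : ∀ r, u r = r * w r)
    (hu : ∀ r ∈ D, HasDerivAt u (v r * (v r ^ 2 + 2 * β * u r ^ 2 - ε) - w r) r)
    (hv : ∀ r ∈ D, HasDerivAt v (-(u r * (ε * α + u r ^ 2 + 2 * β * v r ^ 2))) r) :
    AntitoneOn (fun r => radialEnergy α β ε (u r) (v r)) D := by
  have hd : ∀ r ∈ D, HasDerivAt (fun r => radialEnergy α β ε (u r) (v r))
      (-(r * w r ^ 2 * (ε * α + u r ^ 2 + 2 * β * v r ^ 2))) r := by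
    intro r hr
    have h1 := hu r hr
    have h2 := hv r hr
    have h := (((((h1.pow 2).const_mul (ε * α)).div_const 2).sub
      (((h2.pow 2).const_mul ε).div_const 2)).add
      (((h1.pow 4).add (h2.pow 4)).div_const 4)).add (((h1.pow 2).const_mul β).mul (h2.pow 2))
    refine h.congr_deriv ?_
    simp only [hu0, Pi.pow_apply]
    push_cast
    ring
  refine antitoneOn_of_deriv_nonpos hD (fun r hr => (hd r hr).continuousAt.continuousWithinAt)
    (fun r hr => (hd r (interior_subset hr)).differentiableAt.differentiableWithinAt)
    fun r hr => ?_
  rw [(hd r (interior_subset hr)).deriv]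
  have := hD0 r (interior_subset hr)
  rw [neg_nonpos]
  positivity

/-- Dropping nonnegative terms and completing the square gives `u⁴ + (v² - ε)² ≤ (1 - ε)²`. -/
theorem abs_le_one_of_radialEnergy_le {α β ε : ℝ} (hα : 0 < α) (hβ : 0 < β) (hε : ε ∈ Icc 0 1)
    {u v : ℝ} (h : radialEnergy α β ε u v ≤ radialEnergy α β ε 0 1) : |u| ≤ 1 ∧ |v| ≤ 1 := by
  unfold radialEnergy at h
  obtain ⟨h0, h1⟩ := hε
  have e1 : 0 ≤ ε * α * u ^ 2 := by positivity
  have e2 : 0 ≤ β * u ^ 2 * v ^ 2 := by positivity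
  have key : (u ^ 2) ^ 2 + (v ^ 2 - ε) ^ 2 ≤ (1 - ε) ^ 2 := by nlinarith
  have hu : u ^ 2 ≤ 1 - ε := abs_le_of_sq_le_sq' (by nlinarith [sq_nonneg (v ^ 2 - ε)])
    (by linarith) |>.2
  have hv : v ^ 2 - ε ≤ 1 - ε := abs_le_of_sq_le_sq' (by nlinarith [sq_nonneg (u ^ 2)])
    (by linarith) |>.2
  exact ⟨(sq_le_one_iff_abs_le_one u).1 (by linarith), (sq_le_one_iff_abs_le_one v).1 (by linarith)⟩

/-! ### Truncated fields, with bounds and Lipschitz constants -/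

/-- Truncation at height two. -/
noncomputable def clampTwo (x : ℝ) : ℝ := max (-2) (min 2 x)

theorem continuous_clampTwo : Continuous clampTwo := by unfold clampTwo; fun_prop

theorem abs_clampTwo_le (x : ℝ) : |clampTwo x| ≤ 2 := by
  unfold clampTwo
  rw [abs_le]
  exact ⟨le_max_left _ _, max_le (by norm_num) (min_le_left _ _)⟩

theorem clampTwo_of_abs_le {x : ℝ} (hx : |x| ≤ 2) : clampTwo x = x := by
  rw [abs_le] at hx
  rw [clampTwo, min_eq_right hx.2, max_eq_right hx.1]

theorem abs_clampTwo_sub_le (x y : ℝ) : |clampTwo x - clampTwo y| ≤ |x - y| := by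
  unfold clampTwo
  refine (abs_max_sub_max_le_max _ _ _ _).trans ?_
  rw [sub_self, abs_zero]
  refine max_le (abs_nonneg _) ((abs_min_sub_min_le_max _ _ _ _).trans ?_)
  rw [sub_self, abs_zero]
  exact max_le (abs_nonneg _) le_rfl

theorem clampTwo_neg (x : ℝ) : clampTwo (-x) = -clampTwo x := by
  unfold clampTwo
  grind

/-- The parameter, truncated to the unit interval. -/
noncomputable def clampUnit (x : ℝ) : ℝ := max 0 (min 1 x)

theorem clampUnit_mem (x : ℝ) : clampUnit x ∈ Icc (0 : ℝ) 1 :=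
  ⟨le_max_left _ _, max_le zero_le_one (min_le_left _ _)⟩

theorem clampUnit_of_mem {x : ℝ} (hx : x ∈ Icc (0 : ℝ) 1) : clampUnit x = x := by
  rw [clampUnit, min_eq_right hx.2, max_eq_right hx.1]

theorem abs_clampUnit_sub_le (x y : ℝ) : |clampUnit x - clampUnit y| ≤ |x - y| := by
  unfold clampUnit
  refine (abs_max_sub_max_le_max _ _ _ _).trans ?_
  rw [sub_self, abs_zero]
  refine max_le (abs_nonneg _) ((abs_min_sub_min_le_max _ _ _ _).trans ?_)
  rw [sub_self, abs_zero]
  exact max_le (abs_nonneg _) le_rfl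

/-- The right-hand side `∂H/∂v`. -/
def fieldU (β ε u v : ℝ) : ℝ := v * (v ^ 2 + 2 * β * u ^ 2 - ε)

/-- The right-hand side `∂H/∂u`. -/
def fieldV (α β ε u v : ℝ) : ℝ := u * (ε * α + u ^ 2 + 2 * β * v ^ 2)

theorem abs_mul_le_of_abs_le {a b A B : ℝ} (ha : |a| ≤ A) (hb : |b| ≤ B) : |a * b| ≤ A * B := by
  rw [abs_mul]
  exact mul_le_mul ha hb (abs_nonneg _) ((abs_nonneg _).trans ha)

theorem sq_le_four_of_abs_le {a : ℝ} (ha : |a| ≤ 2) : a ^ 2 ≤ 4 := by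
  rw [← sq_abs]; nlinarith [abs_nonneg a]

theorem abs_fieldU_le {β ε u v : ℝ} (hβ : 0 < β) (hε : ε ∈ Icc (0 : ℝ) 1) (hu : |u| ≤ 2)
    (hv : |v| ≤ 2) :
    |fieldU β ε u v| ≤ 10 + 16 * β := by
  have h1 := sq_le_four_of_abs_le hu
  have h2 := sq_le_four_of_abs_le hv
  have : |v ^ 2 + 2 * β * u ^ 2 - ε| ≤ 5 + 8 * β := by
    rw [abs_le]
    constructor <;> nlinarith [hε.1, hε.2, sq_nonneg u, sq_nonneg v, mul_nonneg hβ.le (sq_nonneg u)]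
  exact (abs_mul_le_of_abs_le hv this).trans (by linarith)

theorem abs_fieldV_le {α β ε u v : ℝ} (hα : 0 < α) (hβ : 0 < β) (hε : ε ∈ Icc (0 : ℝ) 1)
    (hu : |u| ≤ 2) (hv : |v| ≤ 2) :
    |fieldV α β ε u v| ≤ 8 + 2 * α + 16 * β := by
  have h1 := sq_le_four_of_abs_le hu
  have h2 := sq_le_four_of_abs_le hv
  have : |ε * α + u ^ 2 + 2 * β * v ^ 2| ≤ α + 4 + 8 * β := by
    rw [abs_le]
    constructor <;> nlinarith [hε.1, hε.2, sq_nonneg u, sq_nonneg v, mul_nonneg hβ.le (sq_nonneg v),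
      mul_nonneg hε.1 hα.le, mul_nonneg (sub_nonneg.2 hε.2) hα.le]
  exact (abs_mul_le_of_abs_le hu this).trans (by linarith)

theorem abs_sq_add_mul_add_sq_le {u u' : ℝ} (hu : |u| ≤ 2) (hu' : |u'| ≤ 2) :
    |u ^ 2 + u * u' + u' ^ 2| ≤ 12 := by
  have h1 := sq_le_four_of_abs_le hu
  have h2 := sq_le_four_of_abs_le hu'
  rw [abs_le]
  constructor <;> nlinarith [sq_nonneg (u + u'), sq_nonneg (u - u')]

theorem abs_sq_mul_sub_le {u v u' v' d : ℝ} (hu : |u| ≤ 2) (hu' : |u'| ≤ 2) (hv' : |v'| ≤ 2)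
    (hdu : |u - u'| ≤ d) (hdv : |v - v'| ≤ d) :
    |u ^ 2 * v - u' ^ 2 * v'| ≤ 12 * d := by
  have h1 : |u ^ 2| ≤ 4 := by rw [abs_of_nonneg (sq_nonneg u)]; exact sq_le_four_of_abs_le hu
  have h2 : |v' * (u + u')| ≤ 2 * (2 + 2) :=
    abs_mul_le_of_abs_le hv' ((abs_add_le _ _).trans (add_le_add hu hu'))
  have h3 : u ^ 2 * v - u' ^ 2 * v' = u ^ 2 * (v - v') + v' * (u + u') * (u - u') := by ring
  rw [h3]
  refine (abs_add_le _ _).trans ?_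
  have h4 := abs_mul_le_of_abs_le h1 hdv
  have h5 := abs_mul_le_of_abs_le h2 hdu
  linarith

theorem abs_fieldU_sub_le {β ε u v u' v' d : ℝ} (hβ : 0 < β) (hε : ε ∈ Icc (0 : ℝ) 1)
    (hu : |u| ≤ 2) (hv : |v| ≤ 2) (hu' : |u'| ≤ 2) (hv' : |v'| ≤ 2) (hdu : |u - u'| ≤ d)
    (hdv : |v - v'| ≤ d) :
    |fieldU β ε u v - fieldU β ε u' v'| ≤ (13 + 24 * β) * d := by
  have h1 := abs_sq_mul_sub_le hu hu' hv' hdu hdv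
  have h2 := abs_mul_le_of_abs_le (abs_sq_add_mul_add_sq_le hv hv') hdv
  have h3 : |ε * (v - v')| ≤ 1 * d :=
    abs_mul_le_of_abs_le (by rw [abs_of_nonneg hε.1]; exact hε.2) hdv
  have h4 : |2 * β * (u ^ 2 * v - u' ^ 2 * v')| ≤ 2 * β * (12 * d) :=
    abs_mul_le_of_abs_le (by rw [abs_of_pos (by positivity)]) h1
  have h5 : fieldU β ε u v - fieldU β ε u' v' = (v ^ 2 + v * v' + v' ^ 2) * (v - v') +
      2 * β * (u ^ 2 * v - u' ^ 2 * v') - ε * (v - v') := by unfold fieldU; ring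
  rw [h5]
  refine (abs_sub _ _).trans ((add_le_add_left (abs_add_le _ _) _).trans ?_)
  linarith

theorem abs_fieldV_sub_le {α β ε u v u' v' d : ℝ} (hα : 0 < α) (hβ : 0 < β)
    (hε : ε ∈ Icc (0 : ℝ) 1) (hu : |u| ≤ 2) (hv : |v| ≤ 2) (hu' : |u'| ≤ 2) (hv' : |v'| ≤ 2)
    (hdu : |u - u'| ≤ d) (hdv : |v - v'| ≤ d) :
    |fieldV α β ε u v - fieldV α β ε u' v'| ≤ (12 + α + 24 * β) * d := by
  have h1 := abs_sq_mul_sub_le hv hv' hu' hdv hdu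
  have h2 := abs_mul_le_of_abs_le (abs_sq_add_mul_add_sq_le hu hu') hdu
  have h3 : |ε * α * (u - u')| ≤ 1 * α * d := by
    refine abs_mul_le_of_abs_le ?_ hdu
    rw [abs_of_nonneg (mul_nonneg hε.1 hα.le)]
    exact mul_le_mul_of_nonneg_right hε.2 hα.le
  have h4 : |2 * β * (v ^ 2 * u - v' ^ 2 * u')| ≤ 2 * β * (12 * d) :=
    abs_mul_le_of_abs_le (by rw [abs_of_pos (by positivity)]) h1
  have h5 : fieldV α β ε u v - fieldV α β ε u' v' = (u ^ 2 + u * u' + u' ^ 2) * (u - u') +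
      2 * β * (v ^ 2 * u - v' ^ 2 * u') + ε * α * (u - u') := by unfold fieldV; ring
  rw [h5]
  refine (abs_add_le _ _).trans ((add_le_add_left (abs_add_le _ _) _).trans ?_)
  linarith

/-- `fieldU` with truncated arguments. -/
noncomputable def truncU (β ε u v : ℝ) : ℝ :=
  fieldU β (clampUnit ε) (clampTwo u) (clampTwo v)

/-- `fieldV` with truncated arguments. -/
noncomputable def truncV (α β ε u v : ℝ) : ℝ :=
  fieldV α β (clampUnit ε) (clampTwo u) (clampTwo v)

theorem truncU_eq {β ε u v : ℝ} (hε : ε ∈ Icc (0 : ℝ) 1) (hu : |u| ≤ 2) (hv : |v| ≤ 2) :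
    truncU β ε u v = fieldU β ε u v := by
  rw [truncU, clampUnit_of_mem hε, clampTwo_of_abs_le hu, clampTwo_of_abs_le hv]

theorem truncV_eq {α β ε u v : ℝ} (hε : ε ∈ Icc (0 : ℝ) 1) (hu : |u| ≤ 2) (hv : |v| ≤ 2) :
    truncV α β ε u v = fieldV α β ε u v := by
  rw [truncV, clampUnit_of_mem hε, clampTwo_of_abs_le hu, clampTwo_of_abs_le hv]

theorem continuous_truncU (β ε : ℝ) : Continuous fun p : ℝ × ℝ => truncU β ε p.1 p.2 := by
  unfold truncU fieldU
  have := continuous_clampTwo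
  fun_prop

theorem continuous_truncV (α β ε : ℝ) : Continuous fun p : ℝ × ℝ => truncV α β ε p.1 p.2 := by
  unfold truncV fieldV
  have := continuous_clampTwo
  fun_prop

theorem integral_prodMk_eq {f g : ℝ → ℝ} (hf : Continuous f) (hg : Continuous g) (a b : ℝ) :
    ∫ t in a..b, (f t, g t) = (∫ t in a..b, f t, ∫ t in a..b, g t) := by
  have hi : IntervalIntegrable (fun t => (f t, g t)) MeasureTheory.volume a b :=
    (hf.prodMk hg).intervalIntegrable _ _
  exact Prod.ext ((ContinuousLinearMap.fst ℝ ℝ ℝ).intervalIntegral_comp_comm hi).symm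
    ((ContinuousLinearMap.snd ℝ ℝ ℝ).intervalIntegral_comp_comm hi).symm

/-! ### Existence, uniqueness and regularity of profiles -/

/-- Solvability, continuous dependence and uniqueness for the truncated radial system. -/
theorem exists_truncated_profiles {α β : ℝ} (hα : 0 < α) (hβ : 0 < β) :
    ∃ u v : ℝ → ℝ → ℝ, (Continuous fun p : ℝ × ℝ => u p.1 p.2) ∧
      (Continuous fun p : ℝ × ℝ => v p.1 p.2) ∧
      (∀ ε r, u ε r = r * radialAvg 1 (fun s => truncU β ε (u ε s) (v ε s)) r) ∧
      (∀ ε r, v ε r = 1 - r * radialAvg 0 (fun s => truncV α β ε (u ε s) (v ε s)) r) ∧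
      ∀ ε, ∀ y z : ℝ → ℝ, Continuous y → Continuous z →
        (∀ r, y r = r * radialAvg 1 (fun s => truncU β ε (y s) (z s)) r) →
        (∀ r, z r = 1 - r * radialAvg 0 (fun s => truncV α β ε (y s) (z s)) r) →
        y = u ε ∧ z = v ε := by
  let g : ℝ → ℝ → ℝ × ℝ → ℝ × ℝ := fun ε τ x =>
    (τ * truncU β ε x.1 x.2, -truncV α β ε x.1 x.2)
  -- A common majorant of the bounds and the Lipschitz constants of both truncated fields, in the
  -- unknowns and in `ε`.
  let L : ℝ := 13 + 2 * α + 24 * β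
  have hL : 0 < L := by positivity
  have hτ : ∀ τ ∈ Icc (0 : ℝ) 1, ∀ a b : ℝ, |a| ≤ b → |τ * a| ≤ b := by
    intro τ hτ a b hab
    have h := abs_mul_le_of_abs_le (a := τ) (A := 1) (by rw [abs_of_nonneg hτ.1]; exact hτ.2) hab
    rwa [one_mul] at h
  have hmax : ∀ {d : ℝ} (x y : ℝ × ℝ), ‖x - y‖ = d →
      |clampTwo x.1 - clampTwo y.1| ≤ d ∧ |clampTwo x.2 - clampTwo y.2| ≤ d := by
    intro d x y h
    rw [← h]
    exact ⟨(abs_clampTwo_sub_le _ _).trans (norm_fst_le (x - y)),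
      (abs_clampTwo_sub_le _ _).trans (norm_snd_le (x - y))⟩
  have hgcont : ∀ ε, Continuous fun p : ℝ × (ℝ × ℝ) => g ε p.1 p.2 := by
    intro ε
    exact (continuous_fst.mul ((continuous_truncU β ε).comp continuous_snd)).prodMk
      ((continuous_truncV α β ε).comp continuous_snd).neg
  obtain ⟨X, hXc, hXeq, hXuniq⟩ := exists_averaged_volterra g ((0 : ℝ), (1 : ℝ)) hL hgcont
    (by
      intro ε τ ht x
      rw [Prod.norm_def]
      refine max_le (hτ τ ht _ _ ?_) ?_
      · refine (abs_fieldU_le hβ (clampUnit_mem ε) (abs_clampTwo_le _) (abs_clampTwo_le _)).trans ?_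
        simp only [L]; linarith
      · simp only [g, norm_neg]
        refine (abs_fieldV_le hα hβ (clampUnit_mem ε) (abs_clampTwo_le _)
          (abs_clampTwo_le _)).trans ?_
        simp only [L]; linarith)
    (by
      intro ε τ ht x y
      obtain ⟨h1, h2⟩ := hmax x y rfl
      rw [Prod.norm_def]
      refine max_le ?_ ?_
      · simp only [g, Prod.fst_sub, ← mul_sub]
        refine hτ τ ht _ _ ?_
        refine (abs_fieldU_sub_le hβ (clampUnit_mem ε) (abs_clampTwo_le _) (abs_clampTwo_le _)
          (abs_clampTwo_le _) (abs_clampTwo_le _) h1 h2).trans ?_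
        gcongr; simp only [L]; linarith
      · simp only [g, Prod.snd_sub, neg_sub_neg, Real.norm_eq_abs]
        rw [abs_sub_comm]
        refine (abs_fieldV_sub_le hα hβ (clampUnit_mem ε) (abs_clampTwo_le _) (abs_clampTwo_le _)
          (abs_clampTwo_le _) (abs_clampTwo_le _) h1 h2).trans ?_
        gcongr; simp only [L]; linarith)
    (by
      intro ε ε' τ ht x
      have he := abs_clampUnit_sub_le ε ε'
      rw [Prod.norm_def]
      refine max_le ?_ ?_
      · simp only [g, Prod.fst_sub, ← mul_sub]
        refine hτ τ ht _ _ ?_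
        have h1 : truncU β ε x.1 x.2 - truncU β ε' x.1 x.2 =
            -clampTwo x.2 * (clampUnit ε - clampUnit ε') := by unfold truncU fieldU; ring
        rw [h1]
        refine (abs_mul_le_of_abs_le (A := 2) (by rw [abs_neg]; exact abs_clampTwo_le _) he).trans ?_
        gcongr; simp only [L]; linarith
      · simp only [g, Prod.snd_sub, neg_sub_neg, Real.norm_eq_abs]
        have h1 : truncV α β ε' x.1 x.2 - truncV α β ε x.1 x.2 =
            -(α * clampTwo x.1) * (clampUnit ε - clampUnit ε') := by unfold truncV fieldV; ring
        rw [h1]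
        refine (abs_mul_le_of_abs_le (A := α * 2) ?_ he).trans ?_
        · rw [abs_neg]
          exact abs_mul_le_of_abs_le (abs_of_pos hα).le (abs_clampTwo_le _)
        · gcongr; simp only [L]; linarith)
  have key : ∀ ε, ∀ y z : ℝ → ℝ, Continuous y → Continuous z → ∀ r,
      ((0 : ℝ), (1 : ℝ)) + r • ∫ τ in (0 : ℝ)..1, g ε τ (y (r * τ), z (r * τ)) =
      (r * radialAvg 1 (fun s => truncU β ε (y s) (z s)) r,
        1 - r * radialAvg 0 (fun s => truncV α β ε (y s) (z s)) r) := by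
    intro ε y z hy hz r
    have h1 : Continuous fun τ => truncU β ε (y (r * τ)) (z (r * τ)) :=
      (continuous_truncU β ε).comp
        (f := fun τ => (y (r * τ), z (r * τ))) (by fun_prop)
    have h2 : Continuous fun τ => truncV α β ε (y (r * τ)) (z (r * τ)) :=
      (continuous_truncV α β ε).comp
        (f := fun τ => (y (r * τ), z (r * τ))) (by fun_prop)
    have h3 := integral_prodMk_eq (f := fun τ => τ * truncU β ε (y (r * τ)) (z (r * τ)))
      (g := fun τ => -truncV α β ε (y (r * τ)) (z (r * τ))) (continuous_id.mul h1) h2.neg 0 1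
    simp only [g]
    rw [h3]
    ext
    · simp [radialAvg]
    · simp [radialAvg, sub_eq_add_neg]
  have hX1 : ∀ ε, Continuous fun r => (X ε r).1 := fun ε => by fun_prop
  have hX2 : ∀ ε, Continuous fun r => (X ε r).2 := fun ε => by fun_prop
  have hX : ∀ ε r, X ε r = (r * radialAvg 1 (fun s => truncU β ε (X ε s).1 (X ε s).2) r,
        1 - r * radialAvg 0 (fun s => truncV α β ε (X ε s).1 (X ε s).2) r) := by
    intro ε r
    rw [← key ε _ _ (hX1 ε) (hX2 ε) r]
    exact hXeq ε r
  refine ⟨fun ε r => (X ε r).1, fun ε r => (X ε r).2, by fun_prop, by fun_prop,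
    fun ε r => congrArg Prod.fst (hX ε r), fun ε r => congrArg Prod.snd (hX ε r), ?_⟩
  intro ε y z hy hz h1 h2
  have := hXuniq ε (fun r => (y r, z r)) (hy.prodMk hz) fun r => by
    rw [key ε y z hy hz r, ← h1, ← h2]
  exact ⟨funext fun r => congrArg Prod.fst (congrFun this r),
    funext fun r => congrArg Prod.snd (congrFun this r)⟩

/-- As long as the solution stays in the box of height two it solves the true system, and the energy
then confines it to height one. It therefore never reaches the truncation. Smoothness follows by
bootstrapping, since radial averaging preserves `Cⁿ`. -/
theorem isProfile_of_truncated {α β ε : ℝ} (hα : 0 < α) (hβ : 0 < β) (hε : ε ∈ Icc (0 : ℝ) 1)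
    {u v : ℝ → ℝ} (huc : Continuous u) (hvc : Continuous v)
    (hu : ∀ r, u r = r * radialAvg 1 (fun s => truncU β ε (u s) (v s)) r)
    (hv : ∀ r, v r = 1 - r * radialAvg 0 (fun s => truncV α β ε (u s) (v s)) r)
    (hodd : ∀ r, u (-r) = -u r) (heven : ∀ r, v (-r) = v r) :
    IsProfile α β ε u v (radialAvg 1 (fun s => fieldU β ε (u s) (v s))) := by
  have hfc : Continuous fun s => truncU β ε (u s) (v s) :=
    (continuous_truncU β ε).comp (huc.prodMk hvc)
  have hgc : Continuous fun s => truncV α β ε (u s) (v s) :=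
    (continuous_truncV α β ε).comp (huc.prodMk hvc)
  have hu0 : u 0 = 0 := by rw [hu, zero_mul]
  have hv0 : v 0 = 1 := by rw [hv, zero_mul, sub_zero]
  have hdu : ∀ r, HasDerivAt u (truncU β ε (u r) (v r) -
      radialAvg 1 (fun s => truncU β ε (u s) (v s)) r) r := fun r =>
    (hasDerivAt_mul_radialAvg_one hfc r).congr_of_eventuallyEq (Eventually.of_forall hu)
  have hdv : ∀ r, HasDerivAt v (-truncV α β ε (u r) (v r)) r := fun r =>
    ((hasDerivAt_mul_radialAvg_zero hgc r).const_sub 1).congr_of_eventuallyEq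
      (Eventually.of_forall hv)
  have hbox : ∀ D : Set ℝ, Convex ℝ D → 0 ∈ D → (∀ r ∈ D, 0 ≤ r) →
      (∀ r ∈ D, |u r| ≤ 2 ∧ |v r| ≤ 2) → ∀ r ∈ D, |u r| ≤ 1 ∧ |v r| ≤ 1 := by
    intro D hD h0 hD0 hb r hr
    have := antitoneOn_radialEnergy hα hβ hε.1 hD hD0 hu
      (fun r hr => by
        have := hdu r
        rwa [truncU_eq hε (hb r hr).1 (hb r hr).2] at this)
      (fun r hr => by
        have := hdv r
        rwa [truncV_eq hε (hb r hr).1 (hb r hr).2] at this) h0 hr (hD0 r hr)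
    simp only [hu0, hv0] at this
    exact abs_le_one_of_radialEnergy_le hα hβ hε this
  have hpos : ∀ r, 0 ≤ r → |u r| ≤ 2 ∧ |v r| ≤ 2 := by
    intro b hb
    by_contra hcon
    -- At the first radius where the maximum equals two, the energy bound says it is at most one.
    have hcont : Continuous fun r => 2 - max |u r| |v r| := by fun_prop
    obtain ⟨c, hc, hc0, hcpos⟩ := exists_first_zero hb hcont.continuousOn
      (by simp [hu0, hv0]) (by
        rw [sub_nonpos]
        by_contra h
        exact hcon ⟨(le_max_left _ _).trans (not_le.1 h).le, (le_max_right _ _).trans (not_le.1 h).le⟩)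
    have hle : ∀ r ∈ Icc 0 c, |u r| ≤ 2 ∧ |v r| ≤ 2 := by
      intro r hr
      have : 0 ≤ 2 - max |u r| |v r| := by
        rcases hr.2.lt_or_eq with h | rfl
        · exact (hcpos r ⟨hr.1, h⟩).le
        · exact hc0.ge
      exact ⟨(le_max_left _ _).trans (by linarith), (le_max_right _ _).trans (by linarith)⟩
    have h1 := hbox (Icc 0 c) (convex_Icc _ _) ⟨le_rfl, hc.1.le⟩ (fun r hr => hr.1) hle c
      ⟨hc.1.le, le_rfl⟩
    have := max_le h1.1 h1.2
    linarith
  have hone : ∀ r, |u r| ≤ 1 ∧ |v r| ≤ 1 := by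
    intro r
    rcases le_total 0 r with h | h
    · exact hbox (Ici 0) (convex_Ici _) self_mem_Ici (fun r hr => hr) hpos r h
    · have := hbox (Ici 0) (convex_Ici _) self_mem_Ici (fun r hr => hr) hpos (-r)
        (by simpa using h)
      rwa [hodd, heven, abs_neg] at this
  have htU : (fun s => truncU β ε (u s) (v s)) = fun s => fieldU β ε (u s) (v s) := by
    ext s
    exact truncU_eq hε ((hone s).1.trans one_le_two) ((hone s).2.trans one_le_two)
  have htV : (fun s => truncV α β ε (u s) (v s)) = fun s => fieldV α β ε (u s) (v s) := by
    ext s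
    exact truncV_eq hε ((hone s).1.trans one_le_two) ((hone s).2.trans one_le_two)
  rw [htU] at hdu hu
  simp only [fun r => congrFun htU r] at hdu
  simp only [fun r => congrFun htV r] at hdv
  have hsmooth : ∀ n : ℕ, ContDiff ℝ n u ∧ ContDiff ℝ n v := by
    intro n
    induction n with
    | zero => exact ⟨contDiff_zero.2 huc, contDiff_zero.2 hvc⟩
    | succ n ih =>
      obtain ⟨h1, h2⟩ := ih
      have h3 : ContDiff ℝ n fun s => fieldU β ε (u s) (v s) := by unfold fieldU; fun_prop
      have h4 : ContDiff ℝ n fun s => fieldV α β ε (u s) (v s) := by unfold fieldV; fun_prop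
      push_cast
      rw [contDiff_succ_iff_deriv, contDiff_succ_iff_deriv]
      refine ⟨⟨fun r => (hdu r).differentiableAt, by simp, ?_⟩,
        fun r => (hdv r).differentiableAt, by simp, ?_⟩
      · rw [show deriv u = _ from funext fun r => (hdu r).deriv]
        exact h3.sub (contDiff_radialAvg h3)
      · rw [show deriv v = _ from funext fun r => (hdv r).deriv]
        exact h4.neg
  refine ⟨?_, ?_, ?_, heven, hu, hdu, hdv, hv0, fun r => (hone r).1, fun r => (hone r).2⟩
  · refine contDiff_infty.2 fun n => contDiff_radialAvg ?_
    have := (hsmooth n).1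
    have := (hsmooth n).2
    unfold fieldU
    fun_prop
  · exact contDiff_infty.2 fun n => (hsmooth n).2
  · intro r
    unfold radialAvg
    congr 1
    ext τ
    beta_reduce
    rw [neg_mul, hodd, heven]
    unfold fieldU
    ring

/-- The uniqueness clause recognises the explicit solution at `ε = 0`. It uses `(r y)' = r f` so
that a candidate can be checked without dividing by `r`. -/
theorem exists_profiles {α β : ℝ} (hα : 0 < α) (hβ : 0 < β) :
    ∃ u v w : ℝ → ℝ → ℝ, (Continuous fun p : ℝ × ℝ => u p.1 p.2) ∧
      (Continuous fun p : ℝ × ℝ => v p.1 p.2) ∧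
      (∀ ε ∈ Icc (0 : ℝ) 1, IsProfile α β ε (u ε) (v ε) (w ε)) ∧
      ∀ ε ∈ Icc (0 : ℝ) 1, ∀ y z : ℝ → ℝ, Continuous y → (∀ r, |y r| ≤ 2) → (∀ r, |z r| ≤ 2) →
        y 0 = 0 → z 0 = 1 → (∀ r, HasDerivAt (fun r => r * y r) (r * fieldU β ε (y r) (z r)) r) →
        (∀ r, HasDerivAt z (-fieldV α β ε (y r) (z r)) r) → y = u ε ∧ z = v ε := by
  obtain ⟨u, v, huc, hvc, hu, hv, huniq⟩ := exists_truncated_profiles hα hβ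
  have huc' : ∀ ε, Continuous (u ε) := fun ε => by fun_prop
  have hvc' : ∀ ε, Continuous (v ε) := fun ε => by fun_prop
  -- Reflection `(u, v) ↦ (-u(-r), v(-r))` preserves the system, so parity follows from uniqueness.
  have hpar : ∀ ε r, u ε (-r) = -u ε r ∧ v ε (-r) = v ε r := by
    intro ε r
    have hU : ∀ a b, truncU β ε (-a) b = truncU β ε a b := by
      intro a b; unfold truncU fieldU; rw [clampTwo_neg]; ring
    have hV : ∀ a b, truncV α β ε (-a) b = -truncV α β ε a b := by
      intro a b; unfold truncV fieldV; rw [clampTwo_neg]; ring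
    obtain ⟨h1, h2⟩ := huniq ε (fun r => -u ε (-r)) (fun r => v ε (-r)) (by fun_prop) (by fun_prop)
      (fun r => by
        rw [hu]
        simp only [hU, radialAvg, neg_mul]
        ring)
      (fun r => by
        rw [hv]
        simp only [hV, radialAvg, neg_mul, mul_neg, intervalIntegral.integral_neg])
    have h1r := congrFun h1 r
    exact ⟨by linarith, congrFun h2 r⟩
  refine ⟨u, v, fun ε => radialAvg 1 (fun s => fieldU β ε (u ε s) (v ε s)), huc, hvc,
    fun ε hε => isProfile_of_truncated hα hβ hε (huc' ε) (hvc' ε) (hu ε) (hv ε)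
      (fun r => (hpar ε r).1) (fun r => (hpar ε r).2), ?_⟩
  intro ε hε y z hy hyb hzb hy0 hz0 hdy hdz
  have hz : Continuous z := continuous_iff_continuousAt.2 fun r => (hdz r).continuousAt
  have hfU : Continuous fun s => fieldU β ε (y s) (z s) := by unfold fieldU; fun_prop
  have hfV : Continuous fun s => fieldV α β ε (y s) (z s) := by unfold fieldV; fun_prop
  refine huniq ε y z hy hz (fun r => ?_) (fun r => ?_)
  · simp only [fun s => truncU_eq (β := β) hε (hyb s) (hzb s)]
    rcases eq_or_ne r 0 with rfl | hr
    · rw [zero_mul, hy0]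
    · apply mul_left_cancel₀ hr
      rw [← mul_assoc, ← sq, sq_mul_radialAvg_one,
        intervalIntegral.integral_eq_sub_of_hasDerivAt (fun x _ => hdy x)
          ((continuous_id.mul hfU).intervalIntegrable _ _)]
      simp
  · simp only [fun s => truncV_eq (α := α) (β := β) hε (hyb s) (hzb s)]
    rw [mul_radialAvg_zero]
    have := intervalIntegral.integral_eq_sub_of_hasDerivAt (a := 0) (b := r) (fun x _ => hdz x)
      (hfV.neg.intervalIntegrable _ _)
    rw [intervalIntegral.integral_neg, hz0] at this
    linarith

/-! ### The Pohozaev identity and persistence of positive energy -/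

/-- The quantity `∫₀ʳ s (α u² - v²) ds` of the Pohozaev identity. -/
noncomputable def pohozaevIntegral (α : ℝ) (u v : ℝ → ℝ) (r : ℝ) : ℝ :=
  ∫ s in (0 : ℝ)..r, s * (α * u s ^ 2 - v s ^ 2)

theorem hasDerivAt_pohozaevIntegral (α : ℝ) {u v : ℝ → ℝ} (hu : Continuous u) (hv : Continuous v)
    (r : ℝ) : HasDerivAt (pohozaevIntegral α u v) (r * (α * u r ^ 2 - v r ^ 2)) r := by
  have hc : Continuous fun s => s * (α * u s ^ 2 - v s ^ 2) := by fun_prop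
  exact intervalIntegral.integral_hasDerivAt_right (hc.intervalIntegrable _ _)
    (hc.stronglyMeasurableAtFilter _ _) hc.continuousAt

namespace IsProfile

variable {α β ε : ℝ} {u v w : ℝ → ℝ}

theorem continuous_u (h : IsProfile α β ε u v w) : Continuous u :=
  continuous_iff_continuousAt.2 fun r => (h.hasDerivAt_u r).continuousAt

theorem continuous_v (h : IsProfile α β ε u v w) : Continuous v :=
  continuous_iff_continuousAt.2 fun r => (h.hasDerivAt_v r).continuousAt

theorem antitoneOn_energy (h : IsProfile α β ε u v w) (hα : 0 < α) (hβ : 0 < β) (hε : 0 ≤ ε) :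
    AntitoneOn (fun r => radialEnergy α β ε (u r) (v r)) (Ici 0) :=
  antitoneOn_radialEnergy hα hβ hε (convex_Ici 0) (fun _ hr => hr) h.u_eq
    (fun r _ => h.hasDerivAt_u r) fun r _ => h.hasDerivAt_v r

/-- The difference of the two sides vanishes at the origin and has zero derivative along the flow.
-/
theorem pohozaev (h : IsProfile α β ε u v w) (r : ℝ) :
    r ^ 2 * radialEnergy α β ε (u r) (v r) =
      r * u r * v r / 2 + ε * pohozaevIntegral α u v r / 2 := by
  let Φ : ℝ → ℝ := fun r => r ^ 2 * (ε * α * u r ^ 2 / 2 - ε * v r ^ 2 / 2 +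
    (u r ^ 4 + v r ^ 4) / 4 + β * u r ^ 2 * v r ^ 2) - r * u r * v r / 2 -
    ε * pohozaevIntegral α u v r / 2
  have hΦ : ∀ r, HasDerivAt Φ 0 r := by
    intro r
    have h1 := h.hasDerivAt_u r
    have h2 := h.hasDerivAt_v r
    have hF := hasDerivAt_pohozaevIntegral α h.continuous_u h.continuous_v r
    have hE := (((((h1.pow 2).const_mul (ε * α)).div_const 2).sub
      (((h2.pow 2).const_mul ε).div_const 2)).add
      (((h1.pow 4).add (h2.pow 4)).div_const 4)).add (((h1.pow 2).const_mul β).mul (h2.pow 2))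
    have h3 := ((((hasDerivAt_id r).pow 2).mul hE).sub
      ((((hasDerivAt_id r).mul h1).mul h2).div_const 2)).sub ((hF.const_mul ε).div_const 2)
    refine h3.congr_deriv ?_
    simp only [Pi.pow_apply, Pi.add_apply, Pi.sub_apply, Pi.mul_apply, id, h.u_eq]
    push_cast
    ring
  have hconst := is_const_of_deriv_eq_zero (fun r => (hΦ r).differentiableAt)
    (fun r => (hΦ r).deriv) r 0
  have h0 : Φ 0 = 0 := by simp [Φ, pohozaevIntegral]
  rw [h0] at hconst
  simp only [Φ] at hconst
  unfold radialEnergy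
  linarith

/-- Eliminating `u v / r` by the Pohozaev identity, `r² v² (u / v)'` becomes a nonnegative quartic
form times `r²` plus `ε` times the Pohozaev integral. -/
theorem monotoneOn_ratio (h : IsProfile α β ε u v w) (hβ : 0 < β) (hε : 0 ≤ ε) {a b : ℝ}
    (ha : 0 < a) (hv : ∀ r, 0 ≤ r → 0 < v r)
    (hF : ∀ r ∈ Icc a b, 0 ≤ pohozaevIntegral α u v r) :
    MonotoneOn (fun r => u r / v r) (Icc a b) := by
  have hd : ∀ r ∈ Icc a b, HasDerivAt (fun r => u r / v r)
      (((v r * (v r ^ 2 + 2 * β * u r ^ 2 - ε) - w r) * v r -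
        u r * -(u r * (ε * α + u r ^ 2 + 2 * β * v r ^ 2))) / v r ^ 2) r := fun r hr =>
    (h.hasDerivAt_u r).div (h.hasDerivAt_v r) (hv r (ha.le.trans hr.1)).ne'
  refine monotoneOn_of_deriv_nonneg (convex_Icc a b)
    (fun r hr => (hd r hr).continuousAt.continuousWithinAt)
    (fun r hr => (hd r (interior_subset hr)).differentiableAt.differentiableWithinAt)
    fun r hr => ?_
  have hr' := interior_subset hr
  have hr0 : 0 < r := ha.trans_le hr'.1
  rw [(hd r hr').deriv]
  refine div_nonneg ?_ (sq_nonneg _)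
  have hP := h.pohozaev r
  have hF' := hF r hr'
  have hu := h.u_eq r
  unfold radialEnergy at hP
  have key : r ^ 2 * ((v r * (v r ^ 2 + 2 * β * u r ^ 2 - ε) - w r) * v r -
        u r * -(u r * (ε * α + u r ^ 2 + 2 * β * v r ^ 2))) =
      r ^ 2 * ((u r ^ 4 + v r ^ 4) / 2 + 2 * β * u r ^ 2 * v r ^ 2) +
        ε * pohozaevIntegral α u v r := by
    have h1 : r ^ 2 * (w r * v r) = r * u r * v r := by rw [hu]; ring
    linear_combination 2 * hP - h1
  refine (mul_nonneg_iff_of_pos_left (pow_pos hr0 2)).1 ?_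
  rw [key]
  positivity

/-- A self-sustaining loop: while the integral is nonnegative, `u / v` does not decrease, so `αu² ≥
v²` persists and the integral does not decrease either. Hence it never returns to zero, and the
Pohozaev identity has a positive right-hand side. -/
theorem energy_pos_of_pohozaevIntegral_pos (h : IsProfile α β ε u v w) (hα : 0 < α) (hβ : 0 < β)
    (hε : 0 ≤ ε) {a : ℝ} (ha : 0 < a) (hv : ∀ r, 0 ≤ r → 0 < v r) (hu : 0 < u a)
    (huv : v a ^ 2 ≤ α * u a ^ 2) (hF : 0 < pohozaevIntegral α u v a) {r : ℝ} (hr : a ≤ r) :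
    0 < radialEnergy α β ε (u r) (v r) := by
  have hva := hv a ha.le
  have hFd := hasDerivAt_pohozaevIntegral α h.continuous_u h.continuous_v
  have hFc : Continuous (pohozaevIntegral α u v) :=
    continuous_iff_continuousAt.2 fun r => (hFd r).continuousAt
  have hratio : ∀ b, (∀ r ∈ Icc a b, 0 ≤ pohozaevIntegral α u v r) → ∀ r ∈ Icc a b,
      u a / v a ≤ u r / v r := fun b hb r hr =>
    h.monotoneOn_ratio hβ hε ha hv hb ⟨le_rfl, hr.1.trans hr.2⟩ hr hr.1
  have hFpos : ∀ b, a ≤ b → 0 < pohozaevIntegral α u v b := by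
    intro b hb
    by_contra hcon
    obtain ⟨c, hc, hc0, hcpos⟩ := exists_first_zero hb hFc.continuousOn hF (not_lt.1 hcon)
    have hnn : ∀ r ∈ Icc a c, 0 ≤ pohozaevIntegral α u v r := by
      intro r hr
      rcases hr.2.lt_or_eq with h' | rfl
      · exact (hcpos r ⟨hr.1, h'⟩).le
      · exact hc0.ge
    have hmono : MonotoneOn (pohozaevIntegral α u v) (Icc a c) := by
      refine monotoneOn_of_deriv_nonneg (convex_Icc a c) hFc.continuousOn
        (fun r _ => (hFd r).differentiableAt.differentiableWithinAt) fun r hr => ?_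
      have hr' := interior_subset hr
      have hr0 : 0 < r := ha.trans_le hr'.1
      rw [(hFd r).deriv]
      refine mul_nonneg hr0.le ?_
      have h1 := hratio c hnn r hr'
      have hvr := hv r hr0.le
      have h2 : 1 ≤ α * (u a / v a) ^ 2 := by
        rw [div_pow, mul_div_assoc', le_div_iff₀ (by positivity), one_mul]; exact huv
      have h3 : 1 ≤ α * (u r / v r) ^ 2 := by
        refine h2.trans ?_
        have : 0 < u a / v a := div_pos hu hva
        gcongr
      rw [div_pow, mul_div_assoc', le_div_iff₀ (by positivity), one_mul] at h3
      linarith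
    have := hmono ⟨le_rfl, hc.1.le⟩ ⟨hc.1.le, le_rfl⟩ hc.1.le
    linarith
  have hr0 : 0 < r := ha.trans_le hr
  have h1 := hratio r (fun s hs => (hFpos s hs.1).le) r ⟨hr, le_rfl⟩
  have hvr := hv r hr0.le
  have hur : 0 < u r := by
    have : 0 < u r / v r := (div_pos hu hva).trans_le h1
    rwa [div_pos_iff_of_pos_right hvr] at this
  have hP := h.pohozaev r
  have hFr := hFpos r hr
  have : 0 < r ^ 2 * radialEnergy α β ε (u r) (v r) := by rw [hP]; positivity
  exact (mul_pos_iff_of_pos_left (pow_pos hr0 2)).1 this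

end IsProfile

/-! ### The explicit massless solution at `ε = 0` -/

/-- The profile `v` of the massless equation. -/
noncomputable def masslessV (β r : ℝ) : ℝ := (√(1 + β * r ^ 2 + r ^ 4 / 16))⁻¹

theorem masslessV_pos {β : ℝ} (hβ : 0 < β) (r : ℝ) : 0 < masslessV β r := by
  unfold masslessV; positivity

theorem masslessV_sq {β : ℝ} (hβ : 0 < β) (r : ℝ) :
    masslessV β r ^ 2 = (1 + β * r ^ 2 + r ^ 4 / 16)⁻¹ := by
  rw [masslessV, inv_pow, Real.sq_sqrt (by positivity)]

theorem hasDerivAt_masslessV {β : ℝ} (hβ : 0 < β) (r : ℝ) :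
    HasDerivAt (masslessV β) (-(β * r + r ^ 3 / 8) * masslessV β r ^ 3) r := by
  have hD : 0 < 1 + β * r ^ 2 + r ^ 4 / 16 := by positivity
  have h1 := ((((hasDerivAt_id r).pow 2).const_mul β).const_add 1).add
    (((hasDerivAt_id r).pow 4).div_const 16)
  have h2 := (h1.sqrt (by simpa using hD.ne')).inv (by
    simpa using (Real.sqrt_pos.2 hD).ne')
  refine h2.congr_deriv ?_
  have hq : √(1 + β * r ^ 2 + r ^ 4 / 16) ≠ 0 := (Real.sqrt_pos.2 hD).ne'
  simp only [masslessV, Pi.pow_apply, Pi.add_apply, id]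
  push_cast
  field_simp
  ring

/-- Inserting `u = r v / 2` in the Pohozaev identity at `ε = 0` leaves `v² (1 + βr² + r⁴/16) = 1`,
which is where the formula comes from; uniqueness identifies it with the given profile. -/
theorem massless_eq {α β : ℝ} (hβ : 0 < β) {u v : ℝ → ℝ}
    (huniq : ∀ y z : ℝ → ℝ, Continuous y → (∀ r, |y r| ≤ 2) → (∀ r, |z r| ≤ 2) →
        y 0 = 0 → z 0 = 1 → (∀ r, HasDerivAt (fun r => r * y r) (r * fieldU β 0 (y r) (z r)) r) →
        (∀ r, HasDerivAt z (-fieldV α β 0 (y r) (z r)) r) → y = u ∧ z = v) :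
    (u = fun r => r / 2 * masslessV β r) ∧ v = masslessV β := by
  have hd := hasDerivAt_masslessV hβ
  have hc : Continuous (masslessV β) := continuous_iff_continuousAt.2 fun r => (hd r).continuousAt
  have hsq := masslessV_sq hβ
  have hsq' : ∀ r, masslessV β r ^ 2 * (1 + β * r ^ 2 + r ^ 4 / 16) = 1 := by
    intro r
    have hD : 0 < 1 + β * r ^ 2 + r ^ 4 / 16 := by positivity
    rw [hsq, inv_mul_cancel₀ hD.ne']
  obtain ⟨h1, h2⟩ := huniq (fun r => r / 2 * masslessV β r) (masslessV β) (by fun_prop)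
    (fun r => by
      refine abs_le_of_sq_le_sq (b := 2) ?_ (by norm_num)
      have := hsq' r
      have h0 := sq_nonneg (masslessV β r)
      have : masslessV β r ^ 2 * (4 * (1 + β * r ^ 2 + r ^ 4 / 16) - r ^ 2 / 4) ≥ 0 := by
        refine mul_nonneg h0 ?_
        nlinarith [sq_nonneg (r ^ 2 - 1), mul_nonneg hβ.le (sq_nonneg r)]
      rw [mul_pow]
      linarith)
    (fun r => by
      refine abs_le_of_sq_le_sq (b := 2) ?_ (by norm_num)
      have := hsq' r
      have h0 : 0 ≤ masslessV β r ^ 2 * (β * r ^ 2 + r ^ 4 / 16) := by positivity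
      linarith)
    (by simp) (by simp [masslessV])
    (fun r => by
      have h3 := (hasDerivAt_id r).mul (((hasDerivAt_id r).div_const 2).mul (hd r))
      refine h3.congr_deriv ?_
      simp only [fieldU, id, Pi.mul_apply]
      linear_combination (-(r * masslessV β r)) * hsq' r)
    (fun r => by
      refine (hd r).congr_deriv ?_
      simp only [fieldV]
      ring)
  exact ⟨h1.symm, h2.symm⟩

/-- In the massless case the Pohozaev integral is eventually positive: it diverges
logarithmically. -/
theorem exists_massless_pohozaevIntegral_pos {α β : ℝ} (hα : 0 < α) (hβ : 0 < β) :
    ∃ a, 0 < a ∧ masslessV β a ^ 2 < α * (a / 2 * masslessV β a) ^ 2 ∧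
      0 < pohozaevIntegral α (fun r => r / 2 * masslessV β r) (masslessV β) a := by
  have hd := hasDerivAt_masslessV hβ
  have hc : Continuous (masslessV β) := continuous_iff_continuousAt.2 fun r => (hd r).continuousAt
  set F := pohozaevIntegral α (fun r => r / 2 * masslessV β r) (masslessV β)
  have hFd := hasDerivAt_pohozaevIntegral α (u := fun r => r / 2 * masslessV β r)
    (by fun_prop) hc
  -- Beyond `R`, `αr² ≥ 8`, so `αr²/4 - 1 ≥ αr²/8`, while the denominator is at most `(2 + β) r⁴`.
  -- The integrand is therefore at least `c / r` with the `c` below.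
  set R : ℝ := 1 + 8 / α with hR
  have hR1 : 1 ≤ R := by rw [hR]; have : 0 < 8 / α := by positivity
                         linarith
  have hαR : ∀ r, R ≤ r → 8 ≤ α * r ^ 2 := by
    intro r hr
    have h1 : 8 ≤ α * R := by
      rw [hR, mul_add, mul_div_cancel₀ _ hα.ne']; linarith
    nlinarith [mul_le_mul_of_nonneg_left hr hα.le, mul_nonneg hα.le (by linarith : 0 ≤ r)]
  set c : ℝ := α / (8 * (2 + β)) with hcdef
  have hcpos : 0 < c := by positivity
  have hmono : MonotoneOn (fun r => F r - c * Real.log r) (Ici R) := by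
    have hd2 : ∀ r ∈ Ici R, HasDerivAt (fun r => F r - c * Real.log r)
        (r * (α * (r / 2 * masslessV β r) ^ 2 - masslessV β r ^ 2) - c * r⁻¹) r := by
      intro r hr
      have hr0 : r ≠ 0 := by have : R ≤ r := hr
                             linarith
      exact (hFd r).sub ((Real.hasDerivAt_log hr0).const_mul c)
    refine monotoneOn_of_deriv_nonneg (convex_Ici R)
      (fun r hr => (hd2 r hr).continuousAt.continuousWithinAt)
      (fun r hr => (hd2 r (interior_subset hr)).differentiableAt.differentiableWithinAt)
      fun r hr => ?_
    have hr' : R ≤ r := interior_subset hr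
    rw [(hd2 r hr').deriv]
    have hr1 : 1 ≤ r := hR1.trans hr'
    have h8 := hαR r hr'
    have hD : 0 < 1 + β * r ^ 2 + r ^ 4 / 16 := by positivity
    have hDle : 1 + β * r ^ 2 + r ^ 4 / 16 ≤ (2 + β) * r ^ 4 := by
      have h1 : 1 ≤ r ^ 2 := by nlinarith
      have h2 : r ^ 2 ≤ r ^ 4 := by nlinarith
      nlinarith [mul_le_mul_of_nonneg_left h2 hβ.le]
    rw [mul_pow, masslessV_sq hβ, sub_nonneg]
    have e1 : r * (α * ((r / 2) ^ 2 * (1 + β * r ^ 2 + r ^ 4 / 16)⁻¹) -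
        (1 + β * r ^ 2 + r ^ 4 / 16)⁻¹) =
        r * (α * r ^ 2 / 4 - 1) / (1 + β * r ^ 2 + r ^ 4 / 16) := by
      field_simp
      ring
    have e2 : c * r⁻¹ = r * (α * r ^ 2 / 8) / ((2 + β) * r ^ 4) := by
      rw [hcdef]; field_simp
    rw [e1, e2]
    have hr0 : 0 ≤ r := zero_le_one.trans hr1
    exact div_le_div₀ (mul_nonneg hr0 (by linarith))
      (mul_le_mul_of_nonneg_left (by linarith) hr0) hD hDle
  have hlog : Tendsto (fun r => c * Real.log r) atTop atTop :=
    Real.tendsto_log_atTop.const_mul_atTop hcpos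
  obtain ⟨a, ha1, ha2⟩ := ((hlog.eventually_gt_atTop (c * Real.log R - F R)).and
    (eventually_ge_atTop R)).exists
  refine ⟨a, by linarith, ?_, ?_⟩
  · have := masslessV_pos hβ a
    have h8 := hαR a ha2
    have : 0 < masslessV β a ^ 2 * (α * a ^ 2 / 4 - 1) := mul_pos (by positivity) (by linarith)
    nlinarith
  · have := hmono self_mem_Ici ha2 ha2
    simp only at this
    linarith

/-! ### Positivity, limits at infinity and exponential decay -/

theorem AntitoneOn.exists_tendsto_atTop {f : ℝ → ℝ} {a b : ℝ} (hf : AntitoneOn f (Ici a))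
    (hb : ∀ r, a ≤ r → b ≤ f r) :
    ∃ l, Tendsto f atTop (𝓝 l) ∧ b ≤ l ∧ ∀ r, a ≤ r → l ≤ f r := by
  have hanti : Antitone fun r => f (max a r) := fun x y hxy =>
    hf (mem_Ici.2 (le_max_left a x)) (mem_Ici.2 (le_max_left a y)) (max_le_max_left a hxy)
  have hbdd : BddBelow (range fun r => f (max a r)) :=
    ⟨b, by rintro _ ⟨r, rfl⟩; exact hb _ (le_max_left _ _)⟩
  refine ⟨_, (tendsto_atTop_ciInf hanti hbdd).congr' ?_,
    le_ciInf fun r => hb _ (le_max_left _ _), fun r hr => ?_⟩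
  · filter_upwards [eventually_ge_atTop a] with r hr
    rw [max_eq_right hr]
  · have := ciInf_le hbdd r
    simp only [max_eq_right hr] at this
    exact this

namespace IsProfile

variable {α β ε : ℝ} {u v w : ℝ → ℝ}

theorem u_sq_le (h : IsProfile α β ε u v w) (r : ℝ) : u r ^ 2 ≤ 1 :=
  (sq_le_one_iff_abs_le_one _).2 (h.abs_u_le r)

theorem v_sq_le (h : IsProfile α β ε u v w) (r : ℝ) : v r ^ 2 ≤ 1 :=
  (sq_le_one_iff_abs_le_one _).2 (h.abs_v_le r)

/-- The solution does not reach the rest point `(0, 0)` at a finite radius. -/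
theorem ne_zero (h : IsProfile α β ε u v w) (hα : 0 < α) (hβ : 0 < β) (hε : ε ∈ Icc (0 : ℝ) 1)
    {a : ℝ} (ha : 0 < a) : ¬(u a = 0 ∧ v a = 0) := by
  rintro ⟨hua, hva⟩
  -- `C` bounds the coefficient of `2uv` in the derivative of `u² + v²`. The factor `r²` absorbs the
  -- friction, so the weighted quantity below is nondecreasing; if it vanished at `a` it would
  -- vanish on all of `(0, a]`, against `v 0 = 1`.
  set C : ℝ := 3 + α + 4 * β with hC
  have hd : ∀ r, HasDerivAt (fun r => r ^ 2 * (u r ^ 2 + v r ^ 2) * Real.exp (C * r))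
      ((2 * r * v r ^ 2 + r ^ 2 * (C * (u r ^ 2 + v r ^ 2) + 2 * (u r * v r) *
        (v r ^ 2 + 2 * β * u r ^ 2 - ε - (ε * α + u r ^ 2 + 2 * β * v r ^ 2)))) *
        Real.exp (C * r)) r := by
    intro r
    have h1 := h.hasDerivAt_u r
    have h2 := h.hasDerivAt_v r
    have h3 := (((hasDerivAt_id r).pow 2).mul ((h1.pow 2).add (h2.pow 2))).mul
      ((hasDerivAt_id r).const_mul C).exp
    refine h3.congr_deriv ?_
    simp only [Pi.pow_apply, Pi.add_apply, Pi.mul_apply, id, h.u_eq]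
    push_cast
    ring
  have hmono : MonotoneOn (fun r => r ^ 2 * (u r ^ 2 + v r ^ 2) * Real.exp (C * r)) (Ici 0) := by
    refine monotoneOn_of_deriv_nonneg (convex_Ici 0)
      (fun r _ => (hd r).continuousAt.continuousWithinAt)
      (fun r _ => (hd r).differentiableAt.differentiableWithinAt) fun r hr => ?_
    have hr0 : 0 ≤ r := interior_subset hr
    rw [(hd r).deriv]
    refine mul_nonneg (add_nonneg (by positivity) (mul_nonneg (sq_nonneg r) ?_)) (Real.exp_pos _).le
    have hu := h.u_sq_le r
    have hv := h.v_sq_le r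
    have h1 : |v r ^ 2 + 2 * β * u r ^ 2 - ε - (ε * α + u r ^ 2 + 2 * β * v r ^ 2)| ≤ C := by
      have e1 := mul_nonneg hβ.le (sq_nonneg (u r))
      have e2 := mul_nonneg hβ.le (sq_nonneg (v r))
      have e3 := mul_le_mul_of_nonneg_left hu hβ.le
      have e4 := mul_le_mul_of_nonneg_left hv hβ.le
      have e5 := mul_nonneg hε.1 hα.le
      have e6 := mul_le_mul_of_nonneg_right hε.2 hα.le
      have := sq_nonneg (u r)
      have := sq_nonneg (v r)
      rw [abs_le]
      constructor <;> linarith [hε.1, hε.2]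
    have h2 : |2 * (u r * v r)| ≤ u r ^ 2 + v r ^ 2 := by
      rw [abs_le]
      constructor <;> nlinarith [sq_nonneg (u r + v r), sq_nonneg (u r - v r)]
    have h3 := neg_le_of_abs_le (abs_mul_le_of_abs_le h2 h1)
    linarith
  have hzero : ∀ r ∈ Ioc 0 a, v r = 0 := by
    intro r hr
    have h1 := hmono hr.1.le ha.le hr.2
    simp only [hua, hva] at h1
    have h2 : r ^ 2 * (u r ^ 2 + v r ^ 2) * Real.exp (C * r) ≤ 0 := by simpa using h1
    have hr2 := pow_pos hr.1 2
    have h3 : u r ^ 2 + v r ^ 2 ≤ 0 := by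
      by_contra hcon
      have := mul_pos (mul_pos hr2 (not_le.1 hcon)) (Real.exp_pos (C * r))
      linarith
    have h4 : v r ^ 2 = 0 := le_antisymm (by nlinarith [sq_nonneg (u r)]) (sq_nonneg _)
    exact pow_eq_zero_iff two_ne_zero |>.1 h4
  have hcl : (0 : ℝ) ∈ closure (Ioc 0 a) := by
    rw [closure_Ioc ha.ne]; exact ⟨le_rfl, ha.le⟩
  have h0 : v 0 = 0 := closure_minimal (fun r hr => hzero r hr)
    (isClosed_eq h.continuous_v continuous_const) hcl
  exact one_ne_zero (h.v_zero.symm.trans h0)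

/-- A zero of a nonnegative `v` is a minimum, so `v' = 0` there; this forces `u = 0`, the excluded
rest point. -/
theorem v_pos_of_nonneg (h : IsProfile α β ε u v w) (hα : 0 < α) (hβ : 0 < β)
    (hε : ε ∈ Ioc (0 : ℝ) 1) (hv : ∀ r, 0 ≤ r → 0 ≤ v r) {r : ℝ} (hr : 0 ≤ r) : 0 < v r := by
  refine lt_of_le_of_ne (hv r hr) fun h0 => ?_
  have hr0 : 0 < r := by
    refine lt_of_le_of_ne hr ?_
    rintro rfl
    have := h.v_zero
    linarith
  have hmin : IsLocalMin v r := by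
    filter_upwards [lt_mem_nhds hr0] with s hs
    rw [← h0]
    exact hv s hs.le
  have h1 := hmin.hasDerivAt_eq_zero (h.hasDerivAt_v r)
  have h2 : 0 < ε * α + u r ^ 2 + 2 * β * v r ^ 2 := by
    have := mul_pos hε.1 hα
    positivity
  rw [neg_eq_zero, mul_eq_zero] at h1
  exact h.ne_zero hα hβ ⟨hε.1.le, hε.2⟩ hr0 ⟨h1.resolve_right h2.ne', h0.symm⟩

/-- Where `u = 0`, nonnegative energy gives `v² ≥ 2ε`. At a first zero of `w` this makes `u' = v (v²
- ε) > 0`, so `u` cannot have come down to zero. -/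
theorem w_pos_of_energy_nonneg (h : IsProfile α β ε u v w) (hε : 0 < ε)
    (hv : ∀ r, 0 ≤ r → 0 < v r) (hE : ∀ r, 0 ≤ r → 0 ≤ radialEnergy α β ε (u r) (v r))
    {r : ℝ} (hr : 0 ≤ r) : 0 < w r := by
  have hu0 : u 0 = 0 := by rw [h.u_eq, zero_mul]
  have hwd : Differentiable ℝ w := h.contDiff_w.differentiable (by simp)
  have hvE : ∀ r, 0 ≤ r → u r = 0 → 2 * ε ≤ v r ^ 2 := by
    intro r hr hur
    have h1 := hE r hr
    unfold radialEnergy at h1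
    rw [hur] at h1
    have h2 : 0 ≤ v r ^ 2 * (v r ^ 2 - 2 * ε) := by nlinarith
    have := (mul_nonneg_iff_of_pos_left (pow_pos (hv r hr) 2)).1 h2
    linarith
  have hw0 : 0 < w 0 := by
    have h1 : HasDerivAt u (1 * w 0 + 0 * deriv w 0) 0 :=
      ((hasDerivAt_id (0 : ℝ)).mul (hwd 0).hasDerivAt).congr_of_eventuallyEq
        (Eventually.of_forall h.u_eq)
    have h2 := h1.unique (h.hasDerivAt_u 0)
    have h3 := hvE 0 le_rfl hu0
    rw [h.v_zero] at h2 h3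
    rw [hu0] at h2
    nlinarith
  by_contra hcon
  obtain ⟨c, hc, hc0, hcpos⟩ := exists_first_zero hr hwd.continuous.continuousOn hw0
    (not_lt.1 hcon)
  have huc : u c = 0 := by rw [h.u_eq, hc0, mul_zero]
  have hd := h.hasDerivAt_u c
  rw [hc0, sub_zero, huc] at hd
  have hvc := hv c hc.1.le
  have hpos : 0 < v c * (v c ^ 2 + 2 * β * 0 ^ 2 - ε) := by
    have := hvE c hc.1.le huc
    refine mul_pos hvc ?_
    linarith
  have h1 := (hasDerivAt_iff_tendsto_slope.1 hd).eventually (lt_mem_nhds hpos)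
  have h2 : ∀ᶠ s in 𝓝[<] c, 0 < slope u c s :=
    h1.filter_mono (nhdsWithin_mono _ fun s hs => ne_of_lt hs)
  have h3 : ∀ᶠ s in 𝓝[<] c, s ∈ Ioo 0 c := Ioo_mem_nhdsLT hc.1
  obtain ⟨s, hs1, hs2⟩ := (h2.and h3).exists
  rw [slope_def_field, huc, sub_zero, h.u_eq] at hs1
  have h4 : 0 < s * w s := mul_pos hs2.1 (hcpos s ⟨hs2.1.le, hs2.2⟩)
  have h5 := div_neg_of_pos_of_neg h4 (sub_neg.2 hs2.2)
  linarith

theorem antitoneOn_v (h : IsProfile α β ε u v w) (hα : 0 < α) (hβ : 0 < β) (hε : 0 < ε)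
    (hw : ∀ r, 0 ≤ r → 0 < w r) : AntitoneOn v (Ici 0) := by
  refine antitoneOn_of_deriv_nonpos (convex_Ici 0) h.continuous_v.continuousOn
    (fun r _ => (h.hasDerivAt_v r).differentiableAt.differentiableWithinAt) fun r hr => ?_
  have hr0 : 0 ≤ r := interior_subset hr
  have := hw r hr0
  rw [(h.hasDerivAt_v r).deriv, h.u_eq, neg_nonpos]
  positivity

/-- Since `v' ≤ -εα u`, adding `K v` to `u²` compensates any growth of `u²`. Thus `u² + K v` is
monotone and `u²` converges; a positive limit would drive `v` down at a linear rate. -/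
theorem tendsto_u_zero (h : IsProfile α β ε u v w) (hα : 0 < α) (hβ : 0 < β) (hε : 0 < ε)
    (hv : ∀ r, 0 ≤ r → 0 < v r) (hw : ∀ r, 0 ≤ r → 0 < w r) : Tendsto u atTop (𝓝 0) := by
  have hu : ∀ r, 0 ≤ r → 0 ≤ u r := fun r hr => by
    rw [h.u_eq]; exact mul_nonneg hr (hw r hr).le
  obtain ⟨l, hl, -, -⟩ := (h.antitoneOn_v hα hβ hε hw).exists_tendsto_atTop
    fun r hr => (hv r hr).le
  set K : ℝ := 2 * (1 + 2 * β) / (ε * α) with hK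
  have hKεα : K * (ε * α) = 2 * (1 + 2 * β) := div_mul_cancel₀ _ (by positivity)
  have hKpos : 0 < K := by positivity
  have hd : ∀ r, HasDerivAt (fun r => u r ^ 2 + K * v r)
      (2 * u r * (v r * (v r ^ 2 + 2 * β * u r ^ 2 - ε) - w r) +
        K * (-(u r * (ε * α + u r ^ 2 + 2 * β * v r ^ 2)))) r := by
    intro r
    refine (((h.hasDerivAt_u r).pow 2).add ((h.hasDerivAt_v r).const_mul K)).congr_deriv ?_
    push_cast
    ring
  have hanti : AntitoneOn (fun r => u r ^ 2 + K * v r) (Ici 0) := by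
    refine antitoneOn_of_deriv_nonpos (convex_Ici 0)
      (fun r _ => (hd r).continuousAt.continuousWithinAt)
      (fun r _ => (hd r).differentiableAt.differentiableWithinAt) fun r hr => ?_
    have hr0 : 0 ≤ r := interior_subset hr
    rw [(hd r).deriv]
    have hur := hu r hr0
    have hwr := hw r hr0
    have hvr := hv r hr0
    have hv1 : v r ≤ 1 := (le_abs_self _).trans (h.abs_v_le r)
    have h1 : v r * (v r ^ 2 + 2 * β * u r ^ 2 - ε) ≤ 1 + 2 * β := by
      have e1 := h.v_sq_le r
      have e2 := mul_le_mul_of_nonneg_left (h.u_sq_le r) hβ.le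
      have e3 : v r ^ 2 + 2 * β * u r ^ 2 - ε ≤ 1 + 2 * β := by linarith
      have e4 : 0 ≤ 1 + 2 * β := by positivity
      calc v r * (v r ^ 2 + 2 * β * u r ^ 2 - ε) ≤ v r * (1 + 2 * β) :=
            mul_le_mul_of_nonneg_left e3 hvr.le
        _ ≤ 1 * (1 + 2 * β) := mul_le_mul_of_nonneg_right hv1 e4
        _ = _ := one_mul _
    have h2 : 0 ≤ K * (u r * (u r ^ 2 + 2 * β * v r ^ 2)) := by positivity
    have h3 : 2 * u r * (v r * (v r ^ 2 + 2 * β * u r ^ 2 - ε) - w r) +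
        K * (-(u r * (ε * α + u r ^ 2 + 2 * β * v r ^ 2))) =
        2 * u r * (v r * (v r ^ 2 + 2 * β * u r ^ 2 - ε) - (1 + 2 * β)) - 2 * u r * w r -
          K * (u r * (u r ^ 2 + 2 * β * v r ^ 2)) := by
      linear_combination (-u r) * hKεα
    have h4 : 0 ≤ 2 * u r * w r := by positivity
    have h5 : 2 * u r * (v r * (v r ^ 2 + 2 * β * u r ^ 2 - ε) - (1 + 2 * β)) ≤ 0 :=
      mul_nonpos_of_nonneg_of_nonpos (by positivity) (by linarith)
    linarith
  obtain ⟨q, hq, -, -⟩ := hanti.exists_tendsto_atTop (b := 0) fun r hr => by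
    have := hv r hr
    positivity
  have hu2 : Tendsto (fun r => u r ^ 2) atTop (𝓝 (q - K * l)) := by
    refine (hq.sub (hl.const_mul K)).congr fun r => ?_
    ring
  set L := q - K * l
  have hL0 : 0 ≤ L := ge_of_tendsto' hu2 fun r => sq_nonneg _
  have hL : L = 0 := by
    by_contra hne
    have hLpos : 0 < L := lt_of_le_of_ne hL0 (Ne.symm hne)
    obtain ⟨R, hR⟩ := ((hu2.eventually (lt_mem_nhds (half_lt_self hLpos))).and
      (eventually_ge_atTop 0)).exists_forall_of_atTop
    have hR0 : 0 ≤ R := (hR R le_rfl).2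
    have hκ : 0 < ε * α * (L / 2) := by positivity
    have hle := Convex.image_sub_le_mul_sub_of_deriv_le (convex_Ici R) (f := v)
      h.continuous_v.continuousOn
      (fun r _ => (h.hasDerivAt_v r).differentiableAt.differentiableWithinAt)
      (C := -(ε * α * (L / 2))) (fun r hr => by
        have hr' : R ≤ r := interior_subset hr
        obtain ⟨h1, h2⟩ := hR r hr'
        have hur := hu r h2
        have hu1 : u r ≤ 1 := (le_abs_self _).trans (h.abs_u_le r)
        rw [(h.hasDerivAt_v r).deriv, neg_le_neg_iff]
        have h3 : L / 2 ≤ u r := by nlinarith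
        have h4 : 0 ≤ u r * (u r ^ 2 + 2 * β * v r ^ 2) := by positivity
        have h5 := mul_le_mul_of_nonneg_left h3 (mul_pos hε hα).le
        linarith) R self_mem_Ici (R + 2 / (ε * α * (L / 2)))
      (by rw [mem_Ici]; linarith [div_pos two_pos hκ]) (by linarith [div_pos two_pos hκ])
    rw [add_sub_cancel_left, neg_mul, mul_div_cancel₀ _ hκ.ne'] at hle
    have h1 := hv (R + 2 / (ε * α * (L / 2))) (by positivity)
    have h2 := (le_abs_self _).trans (h.abs_v_le R)
    linarith
  rw [hL] at hu2
  have := hu2.sqrt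
  rw [Real.sqrt_zero] at this
  refine this.congr' ?_
  filter_upwards [eventually_ge_atTop 0] with r hr
  exact Real.sqrt_sq (hu r hr)

/-- If `v` tended to `l > 0`, the limiting energy would give `l² ≥ 2ε`, hence `(r u)' ≥ l ε r` and
linear growth of `u`. -/
theorem tendsto_v_zero (h : IsProfile α β ε u v w) (hα : 0 < α) (hβ : 0 < β) (hε : 0 < ε)
    (hv : ∀ r, 0 ≤ r → 0 < v r) (hw : ∀ r, 0 ≤ r → 0 < w r)
    (hE : ∀ r, 0 ≤ r → 0 ≤ radialEnergy α β ε (u r) (v r)) : Tendsto v atTop (𝓝 0) := by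
  have hu := h.tendsto_u_zero hα hβ hε hv hw
  obtain ⟨l, hl, hl0, hlv⟩ := (h.antitoneOn_v hα hβ hε hw).exists_tendsto_atTop
    fun r hr => (hv r hr).le
  have hElim : Tendsto (fun r => radialEnergy α β ε (u r) (v r)) atTop
      (𝓝 (radialEnergy α β ε 0 l)) := by
    have hc : Continuous fun p : ℝ × ℝ => radialEnergy α β ε p.1 p.2 := by
      unfold radialEnergy; fun_prop
    have hp : Tendsto (fun r => (u r, v r)) atTop (𝓝 ((0 : ℝ), l)) := hu.prodMk_nhds hl
    have hcp := (hc.tendsto ((0 : ℝ), l)).comp hp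
    exact hcp
  have hEl : 0 ≤ radialEnergy α β ε 0 l :=
    ge_of_tendsto hElim ((eventually_ge_atTop 0).mono hE)
  rcases hl0.lt_or_eq with hlpos | rfl
  swap
  · exact hl
  exfalso
  have hl2 : 2 * ε ≤ l ^ 2 := by
    unfold radialEnergy at hEl
    have h2 : 0 ≤ l ^ 2 * (l ^ 2 - 2 * ε) := by nlinarith
    have := (mul_nonneg_iff_of_pos_left (pow_pos hlpos 2)).1 h2
    linarith
  have hd : ∀ r, HasDerivAt (fun r => r * u r - l * ε * r ^ 2 / 2)
      (r * (v r * (v r ^ 2 + 2 * β * u r ^ 2 - ε) - l * ε)) r := by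
    intro r
    refine (((hasDerivAt_id r).mul (h.hasDerivAt_u r)).sub
      ((((hasDerivAt_id r).pow 2).const_mul (l * ε)).div_const 2)).congr_deriv ?_
    simp only [id, h.u_eq]
    push_cast
    ring
  have hmono : MonotoneOn (fun r => r * u r - l * ε * r ^ 2 / 2) (Ici 0) := by
    refine monotoneOn_of_deriv_nonneg (convex_Ici 0)
      (fun r _ => (hd r).continuousAt.continuousWithinAt)
      (fun r _ => (hd r).differentiableAt.differentiableWithinAt) fun r hr => ?_
    have hr0 : 0 ≤ r := interior_subset hr
    rw [(hd r).deriv]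
    refine mul_nonneg hr0 (sub_nonneg.2 ?_)
    have h1 := hlv r hr0
    have h2 : l ^ 2 ≤ v r ^ 2 := pow_le_pow_left₀ hlpos.le h1 2
    have h3 : 0 ≤ 2 * β * u r ^ 2 := by positivity
    exact mul_le_mul h1 (by linarith) hε.le (hlpos.le.trans h1)
  -- At this radius the growth bound `u ≥ l ε r / 2` gives `u ≥ 2`, against `|u| ≤ 1`.
  set R := 4 / (l * ε) with hR
  have hRpos : 0 < R := by positivity
  have h1 := hmono self_mem_Ici hRpos.le hRpos.le
  simp only [zero_mul, ne_eq, OfNat.ofNat_ne_zero, not_false_eq_true, zero_pow, mul_zero,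
    zero_div, sub_zero] at h1
  have h2 : l * ε * R = 4 := mul_div_cancel₀ _ (by positivity)
  have h3 : l * ε * R ^ 2 / 2 = R * 2 := by rw [sq, ← mul_assoc, h2]; ring
  have h4 := (le_abs_self _).trans (h.abs_u_le R)
  have h5 := mul_le_mul_of_nonneg_left h4 hRpos.le
  linarith

/-- Near the rest point `E ≥ 0` forces `v ≤ 2√α u`, and then `v' ≤ -εα u ≤ -δ v`. Decay passes to
`u`, which is eventually decreasing, by integrating `v' ≤ -εα u` over `[r - 1, r]`. -/
theorem exponential_decay (h : IsProfile α β ε u v w) (hα : 0 < α) (hβ : 0 < β)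
    (hε : 0 < ε) (hv : ∀ r, 0 ≤ r → 0 < v r)
    (hE : ∀ r, 0 ≤ r → 0 ≤ radialEnergy α β ε (u r) (v r)) :
    ∃ C δ : ℝ, 0 < C ∧ 0 < δ ∧ ∀ r, 0 ≤ r → |u r| + |v r| ≤ C * Real.exp (-δ * r) := by
  have hw : ∀ r, 0 ≤ r → 0 < w r := fun r hr => h.w_pos_of_energy_nonneg hε hv hE hr
  have hu : ∀ r, 0 ≤ r → 0 ≤ u r := fun r hr => by
    rw [h.u_eq]; exact mul_nonneg hr (hw r hr).le
  have hut : Tendsto (fun r => u r ^ 2) atTop (𝓝 0) := by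
    simpa using (h.tendsto_u_zero hα hβ hε hv hw).pow 2
  have hvt : Tendsto (fun r => v r ^ 2) atTop (𝓝 0) := by
    simpa using (h.tendsto_v_zero hα hβ hε hv hw hE).pow 2
  -- The thresholds bound `u⁴/4` by `εαu²/2` and each of `βu²v²`, `v⁴/4` by `εv²/8`, so `E ≥ 0`
  -- becomes `v² ≤ 4αu²`.
  obtain ⟨R, hR⟩ := ((hut.eventually (gt_mem_nhds (by positivity : 0 < 2 * (ε * α)))).and
    ((hut.eventually (gt_mem_nhds (by positivity : 0 < ε / (8 * β)))).and
    ((hvt.eventually (gt_mem_nhds (by positivity : 0 < ε / 2))).and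
    (eventually_ge_atTop 0)))).exists_forall_of_atTop
  have hR0 : 0 ≤ R := (hR R le_rfl).2.2.2
  have hεα : 0 < ε * α := mul_pos hε hα
  have hβu : ∀ r, R ≤ r → β * u r ^ 2 ≤ ε / 8 := by
    intro r hr
    have := (hR r hr).2.1.le
    rw [le_div_iff₀ (by positivity)] at this
    linarith
  have hvu : ∀ r, R ≤ r → v r ≤ 2 * √α * u r := by
    intro r hr
    obtain ⟨h1, -, h3, h4⟩ := hR r hr
    have h2 := hβu r hr
    have hEr := hE r h4
    have hur := hu r h4
    unfold radialEnergy at hEr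
    have e1 := mul_le_mul_of_nonneg_right h1.le (sq_nonneg (u r))
    have e2 := mul_le_mul_of_nonneg_right h2 (sq_nonneg (v r))
    have e3 := mul_le_mul_of_nonneg_right h3.le (sq_nonneg (v r))
    have h5 : ε * v r ^ 2 ≤ ε * (4 * α * u r ^ 2) := by nlinarith
    have h6 := le_of_mul_le_mul_left h5 hε
    refine abs_le_of_sq_le_sq' ?_ (by positivity) |>.2
    rw [mul_pow, mul_pow, Real.sq_sqrt hα.le]
    linarith
  set δ : ℝ := ε * √α / 2 with hδ
  have hsα : 0 < √α := Real.sqrt_pos.2 hα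
  have hδpos : 0 < δ := by positivity
  have hv' : ∀ r, R ≤ r → u r * (ε * α) ≤ u r * (ε * α + u r ^ 2 + 2 * β * v r ^ 2) := by
    intro r hr
    have hur := hu r (hR0.trans hr)
    have : 0 ≤ u r * (u r ^ 2 + 2 * β * v r ^ 2) := by positivity
    linarith
  have hvexp : ∀ r, R ≤ r → v r ≤ Real.exp (δ * R) * Real.exp (-δ * r) := by
    have hd : ∀ r, HasDerivAt (fun r => v r * Real.exp (δ * r))
        ((-(u r * (ε * α + u r ^ 2 + 2 * β * v r ^ 2)) + δ * v r) * Real.exp (δ * r)) r := by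
      intro r
      refine ((h.hasDerivAt_v r).mul ((hasDerivAt_id r).const_mul δ).exp).congr_deriv ?_
      simp only [id]
      ring
    have hanti : AntitoneOn (fun r => v r * Real.exp (δ * r)) (Ici R) := by
      refine antitoneOn_of_deriv_nonpos (convex_Ici R)
        (fun r _ => (hd r).continuousAt.continuousWithinAt)
        (fun r _ => (hd r).differentiableAt.differentiableWithinAt) fun r hr => ?_
      have hr' : R ≤ r := interior_subset hr
      rw [(hd r).deriv]
      refine mul_nonpos_of_nonpos_of_nonneg ?_ (Real.exp_pos _).le
      have h1 := hv' r hr'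
      have h2 := mul_le_mul_of_nonneg_left (hvu r hr') hδpos.le
      have h3 : δ * (2 * √α * u r) = u r * (ε * α) := by
        have := Real.mul_self_sqrt hα.le
        rw [hδ]
        linear_combination (ε * u r) * this
      linarith
    intro r hr
    have h1 := hanti self_mem_Ici hr hr
    have h2 := (le_abs_self _).trans (h.abs_v_le R)
    have h3 : v r * Real.exp (δ * r) ≤ Real.exp (δ * R) :=
      h1.trans (mul_le_of_le_one_left (Real.exp_pos _).le h2)
    rw [neg_mul, Real.exp_neg, ← div_eq_mul_inv, le_div_iff₀ (Real.exp_pos _)]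
    exact h3
  have huanti : AntitoneOn u (Ici R) := by
    refine antitoneOn_of_deriv_nonpos (convex_Ici R) h.continuous_u.continuousOn
      (fun r _ => (h.hasDerivAt_u r).differentiableAt.differentiableWithinAt) fun r hr => ?_
    have hr' : R ≤ r := interior_subset hr
    have hr0 := hR0.trans hr'
    rw [(h.hasDerivAt_u r).deriv]
    have h1 := hβu r hr'
    have h2 := (hR r hr').2.2.1
    have h3 := mul_nonpos_of_nonneg_of_nonpos (hv r hr0).le
      (by linarith : v r ^ 2 + 2 * β * u r ^ 2 - ε ≤ 0)
    linarith [hw r hr0]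
  have huexp : ∀ r, R + 1 ≤ r →
      u r ≤ Real.exp (δ * R) * Real.exp δ / (ε * α) * Real.exp (-δ * r) := by
    intro r hr
    have hle := Convex.image_sub_le_mul_sub_of_deriv_le (convex_Icc (r - 1) r) (f := v)
      h.continuous_v.continuousOn
      (fun s _ => (h.hasDerivAt_v s).differentiableAt.differentiableWithinAt)
      (C := -(u r * (ε * α))) (fun s hs => by
        have hs' := interior_subset hs
        have hsR : R ≤ s := by linarith [hs'.1]
        rw [(h.hasDerivAt_v s).deriv, neg_le_neg_iff]
        have h1 : u r ≤ u s := huanti hsR (hsR.trans hs'.2) hs'.2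
        exact (mul_le_mul_of_nonneg_right h1 hεα.le).trans (hv' s hsR))
      (r - 1) ⟨le_rfl, by linarith⟩ r ⟨by linarith, le_rfl⟩ (by linarith)
    have h1 := hvexp (r - 1) (by linarith)
    have h2 := hv r (by linarith)
    have h3 : u r * (ε * α) ≤ v (r - 1) := by linarith
    have h4 : Real.exp (-δ * (r - 1)) = Real.exp δ * Real.exp (-δ * r) := by
      rw [← Real.exp_add]; ring_nf
    rw [div_mul_eq_mul_div, le_div_iff₀ hεα, mul_assoc, ← h4]
    exact h3.trans h1
  refine ⟨2 * Real.exp (δ * (R + 1)) + (Real.exp (δ * R) * Real.exp δ / (ε * α) +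
    Real.exp (δ * R)), δ, by positivity, hδpos, fun r hr => ?_⟩
  rw [add_mul]
  rcases le_total r (R + 1) with hle | hle
  · have h1 : 1 ≤ Real.exp (δ * (R + 1)) * Real.exp (-δ * r) := by
      rw [← Real.exp_add, Real.one_le_exp_iff]
      nlinarith
    have h2 : 0 ≤ (Real.exp (δ * R) * Real.exp δ / (ε * α) + Real.exp (δ * R)) *
      Real.exp (-δ * r) := by positivity
    linarith [h.abs_u_le r, h.abs_v_le r]
  · rw [abs_of_nonneg (hu r hr), abs_of_pos (hv r hr)]
    have h1 := huexp r hle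
    have h2 := hvexp r (by linarith)
    have h3 : 0 ≤ 2 * Real.exp (δ * (R + 1)) * Real.exp (-δ * r) := by positivity
    linarith

end IsProfile

/-! ### The shooting argument -/

/-- The energy is nonnegative on the axis `v = 0`, and a decreasing energy that is already negative
cannot reach it. -/
theorem IsProfile.v_pos_of_energy_neg {α β ε : ℝ} {u v w : ℝ → ℝ} (h : IsProfile α β ε u v w)
    (hα : 0 < α) (hβ : 0 < β) (hε : 0 ≤ ε) {a : ℝ} (ha : 0 ≤ a) (hva : 0 < v a)
    (hE : radialEnergy α β ε (u a) (v a) < 0) {r : ℝ} (hr : a ≤ r) : 0 < v r := by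
  by_contra hcon
  obtain ⟨c, hc, hc0, -⟩ := exists_first_zero hr h.continuous_v.continuousOn hva (not_lt.1 hcon)
  have h1 : radialEnergy α β ε (u c) (v c) ≤ radialEnergy α β ε (u a) (v a) :=
    h.antitoneOn_energy hα hβ hε ha (ha.trans hc.1.le) hc.1.le
  have h2 : 0 ≤ radialEnergy α β ε (u c) (v c) := by
    rw [hc0]
    unfold radialEnergy
    have : 0 ≤ ε * α * u c ^ 2 / 2 + u c ^ 4 / 4 := by positivity
    linarith
  linarith

/-- The shooting argument: for some value of the parameter, the solution of the rescaled radial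
system keeps `v` positive and its energy nonnegative. -/
theorem exists_localized_profile {α β : ℝ} (hα : 0 < α) (hβ : 0 < β) :
    ∃ ε ∈ Ioc (0 : ℝ) 1, ∃ u v w : ℝ → ℝ, IsProfile α β ε u v w ∧ (∀ r, 0 ≤ r → 0 < v r) ∧
      ∀ r, 0 ≤ r → 0 ≤ radialEnergy α β ε (u r) (v r) := by
  obtain ⟨u, v, w, huc, hvc, hprof, huniq⟩ := exists_profiles hα hβ
  have hIcc : ∀ {ε : ℝ}, ε ∈ Ioc (0 : ℝ) 1 → ε ∈ Icc (0 : ℝ) 1 := fun h => Ioc_subset_Icc_self h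
  -- Positivity of `v` up to `S` belongs to the definition: it makes `A` disjoint from `B`, and by
  -- compactness of `[0, S]` it is an open condition.
  let A : Set ℝ := {ε | ∃ S, 0 ≤ S ∧ radialEnergy α β ε (u ε S) (v ε S) < 0 ∧
    ∀ s ∈ Icc 0 S, 0 < v ε s}
  let B : Set ℝ := {ε | ∃ S, 0 ≤ S ∧ v ε S < 0}
  have hAopen : IsOpen A := by
    rw [isOpen_iff_mem_nhds]
    rintro ε ⟨S, hS, h1, h2⟩
    have hEc : Continuous fun ε => radialEnergy α β ε (u ε S) (v ε S) := by
      unfold radialEnergy; fun_prop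
    have h3 := hEc.continuousAt.eventually (gt_mem_nhds h1)
    have h4 : ∀ᶠ ε' in 𝓝 ε, ∀ s ∈ Icc 0 S, 0 < v ε' s :=
      isCompact_Icc.eventually_forall_of_forall_eventually fun s hs =>
        hvc.continuousAt.eventually (lt_mem_nhds (h2 s hs))
    filter_upwards [h3, h4] with ε' h5 h6
    exact ⟨S, hS, h5, h6⟩
  have hBopen : IsOpen B := by
    rw [isOpen_iff_mem_nhds]
    rintro ε ⟨S, hS, h1⟩
    have hc : Continuous fun ε => v ε S := by fun_prop
    filter_upwards [hc.continuousAt.eventually (gt_mem_nhds h1)] with ε' h2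
    exact ⟨S, hS, h2⟩
  have hApos : ∀ ε ∈ Ioc (0 : ℝ) 1, ε ∈ A → ∀ r, 0 ≤ r → 0 < v ε r := by
    rintro ε hε ⟨S, hS, h1, h2⟩ r hr
    rcases le_total r S with hle | hle
    · exact h2 r ⟨hr, hle⟩
    · exact (hprof ε (hIcc hε)).v_pos_of_energy_neg hα hβ hε.1.le hS (h2 S ⟨hS, le_rfl⟩) h1 hle
  have hdisj : ∀ ε ∈ Ioc (0 : ℝ) 1, ε ∈ A → ε ∉ B := by
    rintro ε hε hA ⟨S, hS, h1⟩
    exact lt_asymm h1 (hApos ε hε hA S hS)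
  have hone : (1 : ℝ) ∈ A := by
    have h1 := hprof 1 ⟨zero_le_one, le_rfl⟩
    refine ⟨0, le_rfl, ?_, fun s hs => ?_⟩
    · rw [h1.v_zero, h1.u_eq, zero_mul]
      unfold radialEnergy
      norm_num
    · rw [Icc_self, mem_singleton_iff] at hs
      rw [hs, h1.v_zero]
      exact one_pos
  have hsmall : ∃ ε ∈ Ioc (0 : ℝ) 1, ε ∉ A := by
    obtain ⟨hu0, hv0⟩ := massless_eq hβ (huniq 0 ⟨le_rfl, zero_le_one⟩)
    obtain ⟨a, ha, h1, h2⟩ := exists_massless_pohozaevIntegral_pos hα hβ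
    have hFc : Continuous fun ε => pohozaevIntegral α (u ε) (v ε) a := by
      unfold pohozaevIntegral
      apply intervalIntegral.continuous_parametric_intervalIntegral_of_continuous'
      fun_prop
    have e1 : ∀ᶠ ε in 𝓝 (0 : ℝ), 0 < pohozaevIntegral α (u ε) (v ε) a := by
      refine hFc.continuousAt.eventually (lt_mem_nhds ?_)
      beta_reduce
      rw [hu0, hv0]; exact h2
    have e2 : ∀ᶠ ε in 𝓝 (0 : ℝ), 0 < u ε a := by
      refine (by fun_prop : Continuous fun ε => u ε a).continuousAt.eventually (lt_mem_nhds ?_)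
      beta_reduce
      rw [hu0]
      have := masslessV_pos hβ a
      positivity
    have e3 : ∀ᶠ ε in 𝓝 (0 : ℝ), 0 < α * u ε a ^ 2 - v ε a ^ 2 := by
      refine (by fun_prop : Continuous fun ε =>
        α * u ε a ^ 2 - v ε a ^ 2).continuousAt.eventually (lt_mem_nhds ?_)
      beta_reduce
      rw [hu0, hv0]
      linarith
    have e4 : ∀ᶠ ε in 𝓝[>] (0 : ℝ), ε ∈ Ioc (0 : ℝ) 1 := Ioc_mem_nhdsGT one_pos
    obtain ⟨ε, ⟨⟨h3, h4⟩, h5⟩, h6⟩ :=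
      ((((e1.and e2).and e3).filter_mono nhdsWithin_le_nhds).and e4).exists
    refine ⟨ε, h6, fun hA => ?_⟩
    have hpos := hApos ε h6 hA
    obtain ⟨S, hS, h7, -⟩ := hA
    have hp := hprof ε (hIcc h6)
    -- At `max a S` the energy is positive by the Pohozaev argument, yet at most its negative value
    -- at `S`.
    have h8 := hp.energy_pos_of_pohozaevIntegral_pos hα hβ h6.1.le ha hpos h4 (by linarith) h3
      (le_max_left a S)
    have h9 : radialEnergy α β ε (u ε (max a S)) (v ε (max a S)) ≤
        radialEnergy α β ε (u ε S) (v ε S) :=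
      hp.antitoneOn_energy hα hβ h6.1.le hS (hS.trans (le_max_right a S)) (le_max_right a S)
    linarith
  obtain ⟨ε, hε, hεA, hεB⟩ : ∃ ε ∈ Ioc (0 : ℝ) 1, ε ∉ A ∧ ε ∉ B := by
    by_contra! hcon
    obtain ⟨ε₀, hε₀, hε₀A⟩ := hsmall
    obtain ⟨ε, hε, hA, hB⟩ := isPreconnected_Ioc (a := (0 : ℝ)) (b := 1) A B hAopen hBopen
      (fun ε hε => or_iff_not_imp_left.2 (hcon ε hε)) ⟨1, ⟨one_pos, le_rfl⟩, hone⟩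
      ⟨ε₀, hε₀, hcon ε₀ hε₀ hε₀A⟩
    exact hdisj ε hε hA hB
  have hp := hprof ε (hIcc hε)
  have hv : ∀ r, 0 ≤ r → 0 < v ε r := fun r hr =>
    hp.v_pos_of_nonneg hα hβ hε (fun s hs => not_lt.1 fun h => hεB ⟨s, hs, h⟩) hr
  exact ⟨ε, hε, u ε, v ε, w ε, hp, hv, fun r hr => not_lt.1 fun h =>
    hεA ⟨r, hr, h, fun s hs => hv s hs.1⟩⟩

/-! ### Undoing the scaling -/

theorem theorem24 (m ω β₁ β₂ : ℝ) (hm : 0 < m) (hω : ω ∈ Set.Ioo (-m) m)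
    (hβ₂ : 0 < β₂) (hβ : β₂ ≤ β₁) :
    ∃ (ψ : Plane → Spinor) (u v : ℝ → ℝ),
      ContDiff ℝ (⊤ : ℕ∞) ψ ∧
      IsStationarySolution m ω β₁ β₂ ψ ∧
      HasRadialForm u v ψ ∧ u 0 = 0 ∧ v 0 ≠ 0 ∧
      ∃ C δ : ℝ, 0 < C ∧ 0 < δ ∧ ∀ x : Plane, ‖ψ x‖ ≤ C * Real.exp (-δ * ‖x‖) := by
  have hβ₁ : 0 < β₁ := hβ₂.trans_le hβ
  have ha : 0 < m + ω := by linarith [hω.1]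
  have hb : 0 < m - ω := by linarith [hω.2]
  have hα : 0 < (m + ω) / (m - ω) := div_pos ha hb
  have hβ' : 0 < β₂ / β₁ := div_pos hβ₂ hβ₁
  obtain ⟨ε, hε, u, v, w, hp, hv, hE⟩ := exists_localized_profile hα hβ'
  obtain ⟨C, δ, hC, hδ, hdecay⟩ := hp.exponential_decay hα hβ' hε.1 hv hE
  -- The radius scales by `μ` and the amplitude by `κ`. Matching the linear terms requires `ε μ = m
  -- - ω`, and matching the cubic ones `β₁ κ² = μ`.
  set μ : ℝ := (m - ω) / ε with hμ
  have hμpos : 0 < μ := div_pos hb hε.1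
  set κ : ℝ := √(μ / β₁) with hκ
  have hκpos : 0 < κ := Real.sqrt_pos.2 (div_pos hμpos hβ₁)
  have hκ1 : β₁ * κ ^ 2 = μ := by
    rw [hκ, Real.sq_sqrt (by positivity), mul_div_cancel₀ _ hβ₁.ne']
  have hκ2 : β₂ * κ ^ 2 = β₂ / β₁ * μ := by rw [← hκ1]; field_simp
  have hbμ : m - ω = ε * μ := (mul_div_cancel₀ _ hε.1.ne').symm
  have haμ : m + ω = ε * ((m + ω) / (m - ω)) * μ := by
    have : ε * μ * ((m + ω) / (m - ω)) = m + ω := by rw [← hbμ, mul_div_cancel₀ _ hb.ne']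
    linarith
  let W : ℝ → ℝ := fun r => κ * μ * w (μ * r)
  let V : ℝ → ℝ := fun r => κ * v (μ * r)
  have hrW : ∀ r, r * W r = κ * u (μ * r) := by
    intro r
    simp only [W, hp.u_eq]
    ring
  have hWs : ContDiff ℝ (⊤ : ℕ∞) W :=
    contDiff_const.mul (hp.contDiff_w.comp (contDiff_const.mul contDiff_id))
  have hVs : ContDiff ℝ (⊤ : ℕ∞) V :=
    contDiff_const.mul (hp.contDiff_v.comp (contDiff_const.mul contDiff_id))
  have hWe : ∀ r, W (-r) = W r := by intro r; simp only [W, mul_neg, hp.even_w]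
  have hVe : ∀ r, V (-r) = V r := by intro r; simp only [V, mul_neg, hp.even_v]
  have hscale : ∀ r, HasDerivAt (fun r => μ * r) μ r := fun r => by
    simpa using (hasDerivAt_id r).const_mul μ
  have hwd : Differentiable ℝ w := hp.contDiff_w.differentiable (by simp)
  have hwode : ∀ r, r * deriv w r + 2 * w r =
      v r * (v r ^ 2 + 2 * (β₂ / β₁) * u r ^ 2 - ε) := by
    intro r
    have h1 : HasDerivAt u (1 * w r + r * deriv w r) r :=
      ((hasDerivAt_id r).mul (hwd r).hasDerivAt).congr_of_eventuallyEq
        (Filter.Eventually.of_forall hp.u_eq)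
    have h2 := h1.unique (hp.hasDerivAt_u r)
    linarith
  refine ⟨profileSpinor W V, fun r => r * W r, V, contDiff_profileSpinor hWs hVs hWe hVe, ?_,
    hasRadialForm_profileSpinor W V, by simp, ?_, 2 * κ * C, δ * μ, by positivity, by positivity,
    fun x => ?_⟩
  · refine isStationarySolution_profileSpinor hWs hVs hWe hVe (fun r _ => ?_) (fun r _ => ?_)
    · have h1 : HasDerivAt W (κ * μ * (deriv w (μ * r) * μ)) r :=
        ((hwd (μ * r)).hasDerivAt.comp r (hscale r)).const_mul (κ * μ)
      rw [h1.deriv, hrW, hbμ]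
      simp only [W, V]
      have h2 := hwode (μ * r)
      linear_combination (κ * μ) * h2 - (κ * v (μ * r) ^ 3) * hκ1 -
        (2 * κ * v (μ * r) * u (μ * r) ^ 2) * hκ2
    · have h1 : HasDerivAt V (κ * (-(u (μ * r) * (ε * ((m + ω) / (m - ω)) + u (μ * r) ^ 2 +
          2 * (β₂ / β₁) * v (μ * r) ^ 2)) * μ)) r :=
        ((hp.hasDerivAt_v (μ * r)).comp r (hscale r)).const_mul κ
      rw [h1.deriv, hrW]
      simp only [V]
      linear_combination (κ * u (μ * r)) * haμ + (κ * u (μ * r) ^ 3) * hκ1 +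
        (2 * κ * u (μ * r) * v (μ * r) ^ 2) * hκ2
  · simp only [V, mul_zero, hp.v_zero, mul_one]
    exact hκpos.ne'
  · refine (norm_profileSpinor_le W V x).trans ?_
    have h1 := hdecay (μ * ‖x‖) (by positivity)
    rw [hrW, abs_mul, abs_mul, abs_of_pos hκpos, ← mul_add]
    have h2 := mul_le_mul_of_nonneg_left h1 hκpos.le
    have h3 : -δ * (μ * ‖x‖) = -(δ * μ) * ‖x‖ := by ring
    rw [h3] at h2
    have h4 : 0 ≤ κ * (C * Real.exp (-(δ * μ) * ‖x‖)) := by positivity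
    linarith
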